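/- Two strings of length $n$ over $\{0,1\}$ are equivalent if one is a cyclic rotation of the other; the equivalence classes are the (binary) necklaces of length $n$. Let $N_n$ be the number of necklaces of length $n$. (Indexing.) There are a deterministic (multi-stack) Turing machine $M$ and a polynomial $p$ with the following properties. On input $(n,j)$, where $n\ge 0$ is a size parameter written in unary and $j\ge 0$ is an index written in binary, $M$ halts after at most $p(n)$ steps, and its output $A^n(j)$ is either a binary string or the special answer "too large". For every $n$ and every $j\in\{1,\dots,N_n\}$, $A^n(j)$ is a string of length $n$, and the map sending $j$ to the necklace that contains $A^n(j)$ is a bijection from $\{1,\dots,N_n\}$ onto the set of necklaces of length $n$. For every $j>N_n$, $A^n(j)$ is "too large". (Nothing is required of the output for $j=0$.) (Reverse-indexing.) There are a deterministic (multi-stack) Turing machine $M'$ and a polynomial $p'$ such that on every input $x\in\{0,1\}^n$, $n\ge 0$, $M'$ halts after at most $p'(n)$ steps and outputs in binary a number $r(x)$ that depends only on the necklace of $x$, and for every $n$ the induced map is a bijection from the set of necklaces of length $n$ onto $\{1,\dots,N_n\}$. -/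

import Mathlib

namespace NecklaceIndexing

/-- The binary necklaces of length `n`. `Cycle Bool` is the type of finite strings over
`Bool = {0, 1}` modulo cyclic rotation. -/
def necklaces (n : ℕ) : Set (Cycle Bool) := {c | c.length = n}

/-- The number of binary necklaces of length `n`. -/
noncomputable def numNecklaces (n : ℕ) : ℕ := (necklaces n).ncard

/-- There are finitely many binary necklaces of each length, so `numNecklaces` is their number. -/
theorem necklaces_finite (n : ℕ) : (necklaces n).Finite := by
  refine ((List.finite_length_eq Bool n).image (fun l : List Bool => (l : Cycle Bool))).subset ?_
  intro c hc
  induction c using Quotient.inductionOn with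
  | h l => exact ⟨l, by simpa [necklaces] using hc, rfl⟩

/-- `A n j` is the answer of an indexing procedure for binary necklaces to the size parameter `n`
and the index `j`: either `some s`, where the string `s` names the necklace of which it is
a representative, or `none`, which stands for "too large". -/
def IsNecklaceIndexing (A : ℕ → ℕ → Option (List Bool)) : Prop :=
  ∀ n : ℕ,
    Set.BijOn (fun j => (A n j).map (fun s : List Bool => (s : Cycle Bool)))
      (Set.Icc 1 (numNecklaces n)) (some '' necklaces n) ∧
    ∀ j, numNecklaces n < j → A n j = none

/-- `r` maps, for each `n`, the binary necklaces of length `n` bijectively to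
`{1, …, numNecklaces n}`. -/
def IsNecklaceReverseIndexing (r : Cycle Bool → ℕ) : Prop :=
  ∀ n : ℕ, Set.BijOn r (necklaces n) (Set.Icc 1 (numNecklaces n))

/-- The multi-stack Turing machine `M`, started on its main label with the word `w` on its input
stack and all other stacks empty, halts after at most `t` steps with exactly the word `v` on its
output stack. -/
def HaltsWithOutput (M : Turing.FinTM2) (w : List (M.Γ M.k₀)) (v : List (M.Γ M.k₁)) (t : ℕ) :
    Prop :=
  ∃ c : M.Cfg, c.l = none ∧ c.stk M.k₁ = v ∧
    Nonempty (StateTransition.EvalsToInTime M.step (Turing.initList M w) (some c) t)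

/-- Some single Turing machine with input alphabet `α` and output alphabet `β` computes `f`
(with inputs and outputs encoded by `ea` and `eb`), making at most `time x` steps on each
input `x`. -/
def ComputableInTime {X Y α β : Type} (ea : X → List α) (eb : Y → List β) (f : X → Y)
    (time : X → ℕ) : Prop :=
  ∃ C : Turing.TM2ComputableAux α β, ∀ x : X,
    HaltsWithOutput C.tm ((ea x).map C.inputAlphabet.symm)
      ((eb (f x)).map C.outputAlphabet.symm) (time x)

/-- The input of an indexing algorithm: `n` tally marks `none` (the size parameter in unary),
then the binary digits of the index `j`, least significant digit first. -/
def encodeIndexInput (x : ℕ × ℕ) : List (Option Bool) :=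
  List.replicate x.1 none ++ (Nat.bits x.2).map some

/-- The output of an indexing algorithm: the string itself, or the one-letter word `none`
for "too large". -/
def encodeIndexOutput : Option (List Bool) → List (Option Bool)
  | some s => s.map some
  | none => [none]

end NecklaceIndexing

/-! Order the necklaces of length `n` by their least representatives, in descending lexicographic
order. The index of a necklace is its `rank`: one plus the number of necklaces whose least
representative is greater. Both directions reduce to counting the necklaces `above n x` a given word
`x`.

By Burnside's lemma (`sum_exceedCount`), `n` times this number is the sum over `i = 1, …, n` of the
number of sequences of period `gcd i n` all of whose windows of length `n` are greater than `x`.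
Where such a sequence first exceeds `x`, it has just read a block `x 0 … x (k - 1) 1` with `x k =
0`. If `x` is a prenecklace, comparisons started inside a block end inside it (`Jump.nest`), so a
periodic sequence is cut into blocks at places that it determines itself, and conversely every
periodic concatenation of blocks exceeds `x` everywhere. There is at most one block of each length
`i`; let `c i` be 1 if it exists and 0 otherwise. Locating the position 0 inside its block gives the
generating series `D / (1 - C)` with `C = ∑ c i t ^ i` and `D = ∑ i c i t ^ i`, hence a linear
recursion with coefficients 0 and 1 (`exceedCount_rec`).

The word with a given rank is found letter by letter: the known prefix, followed by 0 and then by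
ones, is compared with the wanted word through the count above it (`chooseOne_eq`). If this
candidate is not a prenecklace, the next letter must be 1. Conversely, the rank of a necklace comes
from the maximal count over those rotations that are prenecklaces, and the least rotation attains it
(`reverseIndexing_eq`). All counts stay multiplied by `n`; only reverse indexing divides by `n`, at
the end.

For the machines, structured stack programs are compiled to Turing machines (`Cmd.Ev.simulate`). The
class `Poly` of functions on encoded data is closed under composition, pairing, branching and
`n`-fold iteration (`Poly.iterate_id`). Iteration is harmless because sizes may grow only
additively, by a polynomial in `n`. -/

namespace NecklaceIndexing

/-! ### A structured language of stack programs -/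

/-- Structured programs acting on stacks. `pop k P` pops stack `k` and continues with `P o`, where
`o` is the popped symbol, if any; `loop k cont body` repeatedly pops `k` and runs `body o`, as long
as `cont o` holds. -/
inductive Cmd {K : Type} (Γ : K → Type) : Type
  | skip : Cmd Γ
  | push (k : K) (a : Γ k) : Cmd Γ
  | seq (P Q : Cmd Γ) : Cmd Γ
  | pop (k : K) (P : Option (Γ k) → Cmd Γ) : Cmd Γ
  | loop (k : K) (cont : Option (Γ k) → Bool) (body : Option (Γ k) → Cmd Γ) : Cmd Γ

namespace Cmd

variable {K : Type} {Γ : K → Type}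

/-- The labels of the Turing machine that runs a program. -/
def Lab : Cmd Γ → Type
  | skip => Unit
  | push _ _ => Unit
  | seq P Q => Lab P ⊕ Lab Q
  -- The label `none` belongs to the pop itself. The popped symbol becomes part of the label of the
  -- branch, so branching needs no lasting internal memory.
  | pop k P => Option (Σ o : Option (Γ k), Lab (P o))
  | loop k _ body => Option (Σ o : Option (Γ k), Lab (body o))

noncomputable instance labFintype [∀ k, Fintype (Γ k)] : ∀ P : Cmd Γ, Fintype (Lab P)
  | skip => inferInstanceAs (Fintype Unit)
  | push _ _ => inferInstanceAs (Fintype Unit)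
  | seq P Q =>
    have := labFintype P
    have := labFintype Q
    inferInstanceAs (Fintype (Lab P ⊕ Lab Q))
  | pop k P =>
    have := fun o => labFintype (P o)
    inferInstanceAs (Fintype (Option (Σ o : Option (Γ k), Lab (P o))))
  | loop k _ body =>
    have := fun o => labFintype (body o)
    inferInstanceAs (Fintype (Option (Σ o : Option (Γ k), Lab (body o))))

/-- The label at which a program starts. -/
def entry : ∀ P : Cmd Γ, Lab P
  | skip => ()
  | push _ _ => ()
  | seq P _ => Sum.inl (entry P)
  | pop _ _ => none
  | loop _ _ _ => none

/-! ### Compilation and semantics of programs -/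

variable [DecidableEq K]

/-- The symbol of the stack `k` remembered by the internal state of the machine. -/
def remembered (k : K) : Option (Σ k, Γ k) → Option (Γ k)
  | none => none
  | some ⟨k', a⟩ => if h : k' = k then some (h ▸ a) else none

theorem remembered_map (k : K) (o : Option (Γ k)) :
    remembered k (o.map (Sigma.mk k)) = o := by
  cases o <;> simp [remembered]

/-- The machine code of a program, continuing at the label `nxt`. -/
def code {Λ : Type} : ∀ (P : Cmd Γ) (_ : Lab P → Λ) (_ : Λ),
    Lab P → Turing.TM2.Stmt Γ Λ (Option (Σ k, Γ k))
  | skip, _, nxt => fun _ => .goto fun _ => nxt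
  | push k a, _, nxt => fun _ => .push k (fun _ => a) (.goto fun _ => nxt)
  | seq P Q, emb, nxt => fun l =>
    match l with
    | Sum.inl l => code P (fun l => emb (Sum.inl l)) (emb (Sum.inr (entry Q))) l
    | Sum.inr l => code Q (fun l => emb (Sum.inr l)) nxt l
  | pop k P, emb, nxt => fun l =>
    match l with
    | none => .pop k (fun _ o => o.map (Sigma.mk k))
        (.goto fun v => emb (some ⟨remembered k v, entry _⟩))
    | some ⟨o, l⟩ => code (P o) (fun l => emb (some ⟨o, l⟩)) nxt l
  | loop k cont body, emb, nxt => fun l =>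
    match l with
    | none => .pop k (fun _ o => o.map (Sigma.mk k))
        (.goto fun v => emb (some ⟨remembered k v, entry _⟩))
    | some ⟨o, l⟩ => code (body o) (fun l => emb (some ⟨o, l⟩))
        (if cont o then emb none else nxt) l

/-- The label inside a program with a branch selected by the popped symbol. -/
def inner {k : K} {P : Option (Γ k) → Cmd Γ} (o : Option (Γ k)) (l : Lab (P o)) :
    Option (Σ o : Option (Γ k), Lab (P o)) := some ⟨o, l⟩

theorem code_pop_entry {Λ : Type} (k) (P : Option (Γ k) → Cmd Γ) (emb : Lab (pop k P) → Λ)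
    (nxt : Λ) : code (pop k P) emb nxt (pop k P).entry =
      .pop k (fun _ o => o.map (Sigma.mk k))
        (.goto fun v => emb (inner (remembered k v) (entry _))) := by
  rw [entry, code]; rfl

theorem code_pop_inner {Λ : Type} (k) (P : Option (Γ k) → Cmd Γ) (emb : Lab (pop k P) → Λ)
    (nxt : Λ) (o : Option (Γ k)) (l : Lab (P o)) :
    code (pop k P) emb nxt (inner o l) = code (P o) (fun l => emb (inner o l)) nxt l := by
  rw [inner, code]; rfl

theorem code_loop_entry {Λ : Type} (k) (cont) (P : Option (Γ k) → Cmd Γ)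
    (emb : Lab (loop k cont P) → Λ) (nxt : Λ) :
    code (loop k cont P) emb nxt (loop k cont P).entry =
      .pop k (fun _ o => o.map (Sigma.mk k))
        (.goto fun v => emb (inner (remembered k v) (entry _))) := by
  rw [entry, code]; rfl

theorem code_loop_inner {Λ : Type} (k) (cont) (P : Option (Γ k) → Cmd Γ)
    (emb : Lab (loop k cont P) → Λ) (nxt : Λ) (o : Option (Γ k)) (l : Lab (P o)) :
    code (loop k cont P) emb nxt (inner o l) =
      code (P o) (fun l => emb (inner o l))
        (if cont o then emb (loop k cont P).entry else nxt) l := by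
  rw [inner, code]; rfl

/-- `Ev P s s' t`: the program `P` transforms the stacks `s` into `s'` in `t` steps. -/
inductive Ev : Cmd Γ → (∀ k, List (Γ k)) → (∀ k, List (Γ k)) → ℕ → Prop
  | skip (s) : Ev skip s s 1
  | push (k a s) : Ev (push k a) s (Function.update s k (a :: s k)) 1
  | seq {P Q s s' s'' t t'} : Ev P s s' t → Ev Q s' s'' t' → Ev (seq P Q) s s'' (t + t')
  | pop {k P s s' t} : Ev (P (s k).head?) (Function.update s k (s k).tail) s' t →
      Ev (pop k P) s s' (1 + t)
  | loop_exit {k cont body s s' t} : cont (s k).head? = false →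
      Ev (body (s k).head?) (Function.update s k (s k).tail) s' t →
      Ev (loop k cont body) s s' (1 + t)
  | loop_next {k cont body s s' s'' t t'} : cont (s k).head? = true →
      Ev (body (s k).head?) (Function.update s k (s k).tail) s' t →
      Ev (loop k cont body) s' s'' t' →
      Ev (loop k cont body) s s'' (1 + t + t')

theorem iterate_bind_add {A : Type} (f : A → Option A) {a b c : Option A} {m n : ℕ}
    (h : (flip bind f)^[m] a = b) (h' : (flip bind f)^[n] b = c) :
    (flip bind f)^[m + n] a = c := by
  rw [add_comm, Function.iterate_add_apply, h, h']

/-- The machine, its labels and the embedding are arbitrary because in the induction a subprogram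
runs inside the machine of a larger one. The internal state may be arbitrary before and after: it is
read only by a jump that directly follows the pop setting it. -/
theorem Ev.simulate {P : Cmd Γ} {s s' : ∀ k, List (Γ k)} {t : ℕ} (h : Ev P s s' t) :
    ∀ {Λ : Type} (m : Λ → Turing.TM2.Stmt Γ Λ (Option (Σ k, Γ k))) (emb : Lab P → Λ) (nxt : Λ),
      (∀ l, m (emb l) = code P emb nxt l) → ∀ v, ∃ v',
        (flip bind (Turing.TM2.step m))^[t] (some ⟨some (emb (entry P)), v, s⟩) =
          some ⟨some nxt, v', s'⟩ := by
  induction h with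
  | skip s =>
    intro Λ m emb nxt hm v
    exact ⟨v, by simp [flip, hm, code]⟩
  | push k a s =>
    intro Λ m emb nxt hm v
    exact ⟨v, by simp [flip, hm, code]⟩
  | @seq P Q s s' s'' t t' h h' ih ih' =>
    intro Λ m emb nxt hm v
    obtain ⟨v₁, h₁⟩ := ih m (fun l => emb (Sum.inl l)) (emb (Sum.inr (entry Q)))
      (fun l => hm (Sum.inl l)) v
    obtain ⟨v₂, h₂⟩ := ih' m (fun l => emb (Sum.inr l)) nxt (fun l => hm (Sum.inr l)) v₁
    exact ⟨v₂, iterate_bind_add _ h₁ h₂⟩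
  | @pop k P s s' t h ih =>
    intro Λ m emb nxt hm v
    obtain ⟨v₁, h₁⟩ := ih m (fun l => emb (inner _ l)) nxt
      (fun l => (hm _).trans (code_pop_inner ..))
      ((s k).head?.map (Sigma.mk k))
    refine ⟨v₁, iterate_bind_add _ (m := 1) ?_ h₁⟩
    simp only [Function.iterate_one, flip, Option.bind_eq_bind, Option.bind_some,
      Turing.TM2.step, hm, code_pop_entry, Turing.TM2.stepAux]
    rw [remembered_map]
  | @loop_exit k cont body s s' t hc h ih =>
    intro Λ m emb nxt hm v
    obtain ⟨v₁, h₁⟩ := ih m (fun l => emb (inner _ l)) nxt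
      (fun l => (hm _).trans ((code_loop_inner ..).trans (by simp [hc]))) ((s k).head?.map (Sigma.mk k))
    refine ⟨v₁, iterate_bind_add _ (m := 1) ?_ h₁⟩
    simp only [Function.iterate_one, flip, Option.bind_eq_bind, Option.bind_some,
      Turing.TM2.step, hm, code_loop_entry, Turing.TM2.stepAux]
    rw [remembered_map]
  | @loop_next k cont body s s' s'' t t' hc h h' ih ih' =>
    intro Λ m emb nxt hm v
    obtain ⟨v₁, h₁⟩ := ih m (fun l => emb (inner _ l)) (emb (entry _))
      (fun l => (hm _).trans ((code_loop_inner ..).trans (by simp [hc]))) ((s k).head?.map (Sigma.mk k))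
    obtain ⟨v₂, h₂⟩ := ih' m emb nxt hm v₁
    refine ⟨v₂, iterate_bind_add _ (iterate_bind_add _ (m := 1) ?_ h₁) h₂⟩
    simp only [Function.iterate_one, flip, Option.bind_eq_bind, Option.bind_some,
      Turing.TM2.step, hm, code_loop_entry, Turing.TM2.stepAux]
    rw [remembered_map]

/-- The Turing machine that runs a program. -/
noncomputable def toTM2 [Fintype K] [∀ k, Fintype (Γ k)] (P : Cmd Γ) (k₀ k₁ : K) :
    Turing.FinTM2 where
  K := K
  k₀ := k₀
  k₁ := k₁
  Γ := Γ
  Λ := Option (Lab P)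
  main := some (entry P)
  σ := Option (Σ k, Γ k)
  initialState := none
  m
    | none => .halt
    | some l => code P some none l

theorem Ev.haltsWithOutput [Fintype K] [∀ k, Fintype (Γ k)] {P : Cmd Γ} {k₀ k₁ : K}
    {w : List (Γ k₀)} {s' : ∀ k, List (Γ k)} {t T : ℕ}
    (h : Ev P (Function.update (fun _ => []) k₀ w) s' t) (hT : t + 1 ≤ T) :
    HaltsWithOutput (toTM2 P k₀ k₁) w (s' k₁) T := by
  obtain ⟨v, hv⟩ := h.simulate (toTM2 P k₀ k₁).m some none (fun l => rfl) none
  -- The additional step executes the `halt` at the final label.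
  refine ⟨⟨none, v, s'⟩, rfl, rfl, ⟨⟨⟨t + 1, ?_⟩, hT⟩⟩⟩
  refine iterate_bind_add _ (b := some ⟨some none, v, s'⟩) ?_ (n := 1) ?_
  · refine Eq.trans ?_ hv
    congr 2
    simp only [Turing.initList]
    congr 1
    funext (k : K)
    by_cases hk : k = k₀
    · subst hk
      exact (dif_pos rfl).trans (by simp only [Function.update_self]; rfl)
    · exact (dif_neg hk).trans (Function.update_of_ne hk w fun _ => []).symm
  · rfl

end Cmd

end NecklaceIndexing

namespace NecklaceIndexing

open Cmd

/-! ### Stacks, encodings of data -/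

/-- The working stacks: a unary size parameter, loop counters, the main stack and three auxiliary
stacks. -/
inductive Work
  | siz | ctr | top | x | y | z
  deriving DecidableEq

instance : Fintype Work :=
  ⟨{.siz, .ctr, .top, .x, .y, .z}, fun k => by cases k <;> simp⟩

/-- The stacks of our machines: input, output and working stacks. -/
inductive Stacks
  | inp | out | w (k : Work)
  deriving DecidableEq, Fintype

/-- The symbols on working stacks. -/
abbrev Sym := Option Bool

/-- The alphabets of the stacks, with input alphabet `I` and output alphabet `O`. -/
abbrev Alph (I O : Type) : Stacks → Type
  | .inp => I
  | .out => O
  | .w _ => Sym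

instance alphFintype (I O : Type) [Fintype I] [Fintype O] : ∀ k, Fintype (Alph I O k)
  | .inp => inferInstanceAs (Fintype I)
  | .out => inferInstanceAs (Fintype O)
  | .w _ => inferInstanceAs (Fintype Sym)

/-- The contents of the working stacks. -/
def works (n c m x y z : List Sym) : Work → List Sym
  | .siz => n
  | .ctr => c
  | .top => m
  | .x => x
  | .y => y
  | .z => z

/-- The contents of all stacks. -/
def stk {I O : Type} (i : List I) (o : List O) (f : Work → List Sym) : ∀ k, List (Alph I O k)
  | .inp => i
  | .out => o
  | .w k => f k

section Update

variable {I O : Type} (i i' : List I) (o o' : List O) (f : Work → List Sym)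
  (n c m x y z l : List Sym) (k : Work)

@[simp] theorem stk_w : stk i o f (.w k) = f k := rfl
@[simp] theorem stk_inp : stk i o f .inp = i := rfl
@[simp] theorem stk_out : stk i o f .out = o := rfl

@[simp] theorem update_stk_w :
    Function.update (stk i o f) (.w k) l = stk i o (Function.update f k l) := by
  funext k'
  rcases k' with _ | _ | k'
  · simp
  · simp
  · by_cases h : k' = k
    · subst h; simp
    · simp [h]

@[simp] theorem update_stk_inp : Function.update (stk i o f) .inp i' = stk i' o f := by
  funext k'
  rcases k' with _ | _ | k' <;> simp

@[simp] theorem update_stk_out : Function.update (stk i o f) .out o' = stk i o' f := by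
  funext k'
  rcases k' with _ | _ | k' <;> simp

@[simp] theorem works_siz : works n c m x y z .siz = n := rfl
@[simp] theorem works_ctr : works n c m x y z .ctr = c := rfl
@[simp] theorem works_top : works n c m x y z .top = m := rfl
@[simp] theorem works_x : works n c m x y z .x = x := rfl
@[simp] theorem works_y : works n c m x y z .y = y := rfl
@[simp] theorem works_z : works n c m x y z .z = z := rfl

@[simp] theorem update_works_siz :
    Function.update (works n c m x y z) .siz l = works l c m x y z := by
  funext k; cases k <;> rfl
@[simp] theorem update_works_ctr :
    Function.update (works n c m x y z) .ctr l = works n l m x y z := by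
  funext k; cases k <;> rfl
@[simp] theorem update_works_top :
    Function.update (works n c m x y z) .top l = works n c l x y z := by
  funext k; cases k <;> rfl
@[simp] theorem update_works_x :
    Function.update (works n c m x y z) .x l = works n c m l y z := by
  funext k; cases k <;> rfl
@[simp] theorem update_works_y :
    Function.update (works n c m x y z) .y l = works n c m x l z := by
  funext k; cases k <;> rfl
@[simp] theorem update_works_z :
    Function.update (works n c m x y z) .z l = works n c m x y l := by
  funext k; cases k <;> rfl

end Update

/-- Programs over our stacks. -/
abbrev Prog (I O : Type) := Cmd (Alph I O)

/-- The contents of all stacks. -/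
abbrev State (I O : Type) := ∀ k, List (Alph I O k)

/-! ### Time bounds; moving and clearing stacks -/

section Runs

variable {I O : Type}

/-- The program `P` transforms `s` into `s'` in at most `T` steps. -/
def Runs (P : Prog I O) (s s' : State I O) (T : ℕ) : Prop := ∃ t ≤ T, Ev P s s' t

variable {P Q : Prog I O} {s s' s'' : State I O} {T T' : ℕ}

theorem Runs.mono (h : Runs P s s' T) (hT : T ≤ T') : Runs P s s' T' :=
  let ⟨t, ht, h⟩ := h
  ⟨t, ht.trans hT, h⟩

theorem Runs.congr {s₁ s₁' : State I O} (h : Runs P s s' T) (hs : s = s₁) (hs' : s' = s₁')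
    (hT : T ≤ T') : Runs P s₁ s₁' T' := by
  subst hs hs'
  exact h.mono hT

theorem Runs.seq (h : Runs P s s' T) (h' : Runs Q s' s'' T') :
    Runs (P.seq Q) s s'' (T + T') :=
  let ⟨_, ht, h⟩ := h
  let ⟨_, ht', h'⟩ := h'
  ⟨_, add_le_add ht ht', h.seq h'⟩

theorem Runs.skip (s : State I O) : Runs .skip s s 1 := ⟨1, le_rfl, .skip s⟩

theorem Runs.push (k) (a : Alph I O k) (h : Function.update s k (a :: s k) = s') :
    Runs (.push k a) s s' 1 := ⟨1, le_rfl, h ▸ .push k a s⟩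

theorem Runs.pop {k} {P : Option (Alph I O k) → Prog I O}
    (h : Runs (P (s k).head?) (Function.update s k (s k).tail) s' T) :
    Runs (.pop k P) s s' (1 + T) :=
  let ⟨_, ht, h⟩ := h
  ⟨_, by omega, .pop h⟩

theorem Runs.loop_exit {k cont} {P : Option (Alph I O k) → Prog I O}
    (hc : cont (s k).head? = false)
    (h : Runs (P (s k).head?) (Function.update s k (s k).tail) s' T) :
    Runs (.loop k cont P) s s' (1 + T) :=
  let ⟨_, ht, h⟩ := h
  ⟨_, by omega, .loop_exit hc h⟩

theorem Runs.loop_next {k cont} {P : Option (Alph I O k) → Prog I O}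
    (hc : cont (s k).head? = true)
    (h : Runs (P (s k).head?) (Function.update s k (s k).tail) s' T)
    (h' : Runs (.loop k cont P) s' s'' T') :
    Runs (.loop k cont P) s s'' (1 + T + T') :=
  let ⟨_, ht, h⟩ := h
  let ⟨_, ht', h'⟩ := h'
  ⟨_, by omega, .loop_next hc h h'⟩

/-- Run `body` on all symbols popped from the stack `k` until it is empty. -/
def drain (k : Work) (body : Sym → Prog I O) : Prog I O :=
  .loop (.w k) Option.isSome fun o => o.elim .skip body

/-- Move the stack `k` symbol by symbol to the stack `k'`. -/
def pour (k k' : Work) : Prog I O := drain k fun a => .push (.w k') a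

/-- Move the stack `x` symbol by symbol to both stacks `k` and `k'`. -/
def pour₂ (k k' : Work) : Prog I O :=
  drain .x fun a => .seq (.push (.w k) a) (.push (.w k') a)

/-- Empty the stack `k`. -/
def clear (k : Work) : Prog I O := drain k fun _ => .skip

theorem runs_drain_nil {k body} (h : s (.w k) = []) : Runs (drain k body) s s 2 := by
  have hs : Function.update s (.w k) ([] : List Sym).tail = s := by
    rw [List.tail_nil, ← h, Function.update_eq_self]
  refine Runs.loop_exit (T := 1) (by rw [h]; rfl) ?_
  rw [h, hs]
  exact .skip s

theorem runs_drain_cons {k body} {a : Sym} {l : List Sym} (h : s (.w k) = a :: l)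
    (h₁ : Runs (body a) (Function.update s (.w k) l) s' T) (h₂ : Runs (drain k body) s' s'' T') :
    Runs (drain k body) s s'' (1 + T + T') := by
  refine Runs.loop_next (by rw [h]; rfl) ?_ h₂
  rw [h]
  exact h₁

variable (i : List I) (o : List O) (n c m x y z : List Sym)

theorem runs_pour (k k' : Work) (hk : k ≠ k') (f : Work → List Sym) :
    Runs (pour k k') (stk i o f)
      (stk i o (Function.update (Function.update f k []) k' ((f k).reverse ++ f k')))
      (2 * (f k).length + 2) := by
  generalize hl : f k = l
  induction l generalizing f with
  | nil =>
    have hf : Function.update f k [] = f := by rw [← hl, Function.update_eq_self]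
    exact (runs_drain_nil (s := stk i o f) hl).congr rfl (by simp [hf]) (by simp)
  | cons a l ih =>
    refine (runs_drain_cons (T := 1) hl (Runs.push _ _ rfl)
      (T' := 2 * l.length + 2) ?_).mono (by
        simp only [List.length_cons]; omega)
    · have := ih (Function.update (Function.update f k l) k' (a :: f k')) (by simp [hk])
      refine this.congr ?_ ?_ le_rfl
      · simp [hk.symm]
      · simp only [Function.update_self, List.reverse_cons, List.append_assoc,
          List.singleton_append]
        rw [Function.update_comm hk.symm]
        simp

theorem runs_clear (k : Work) (f : Work → List Sym) :
    Runs (clear k) (stk i o f) (stk i o (Function.update f k [])) (2 * (f k).length + 2) := by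
  generalize hl : f k = l
  induction l generalizing f with
  | nil =>
    have hf : Function.update f k [] = f := by rw [← hl, Function.update_eq_self]
    exact (runs_drain_nil (s := stk i o f) hl).congr rfl (by simp [hf]) (by simp)
  | cons a l ih =>
    refine (runs_drain_cons hl (Runs.skip _) (T' := 2 * l.length + 2) ?_).mono
      (by simp; omega)
    exact (ih (Function.update f k l) (by simp)).congr (by simp) (by simp) le_rfl

theorem runs_pour₂ (k k' : Work) (hk : k ≠ .x) (hk' : k' ≠ .x) (hkk : k ≠ k')
    (f : Work → List Sym) :
    Runs (pour₂ k k') (stk i o f)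
      (stk i o (Function.update (Function.update (Function.update f .x []) k
        ((f .x).reverse ++ f k)) k' ((f .x).reverse ++ f k')))
      (3 * (f .x).length + 2) := by
  generalize hl : f .x = l
  induction l generalizing f with
  | nil =>
    have hf : Function.update f .x [] = f := by rw [← hl, Function.update_eq_self]
    exact (runs_drain_nil (s := stk i o f) hl).congr rfl (by simp [hf]) (by simp)
  | cons a l ih =>
    refine (runs_drain_cons (T := 1 + 1) hl
      (.seq (Runs.push _ _ rfl) (Runs.push _ _ rfl))
      (T' := 3 * l.length + 2) ?_).mono (by
        simp only [List.length_cons]; omega)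
    have := ih (Function.update (Function.update (Function.update f .x l) k (a :: f k)) k'
      (a :: f k')) (by simp [hk.symm, hk'.symm])
    refine this.congr ?_ ?_ le_rfl
    · simp [hk, hk', hkk.symm]
    · congr 1
      funext j
      by_cases h1 : j = k'
      · subst h1; simp
      · by_cases h2 : j = k
        · subst h2; simp [h1]
        · by_cases h3 : j = .x
          · subst h3; simp [h1, h2]
          · simp [h1, h2, h3]

end Runs

/-- Types of data with a self-delimiting encoding on a stack. The size of a compound datum is
the maximum of the sizes of its parts. -/
class Data (α : Type) where
  /-- the encoding -/
  enc : α → List Sym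
  /-- the size -/
  size : α → ℕ
  /-- a polynomial bound for the length of the encoding in terms of the size -/
  len : Polynomial ℕ
  enc_len (a : α) : (enc a).length ≤ len.eval (size a)
  /-- the program that moves an encoding symbol by symbol from the stack `top` to `x` -/
  mv (I O : Type) : Prog I O
  mv_spec {I O : Type} (a : α) (i : List I) (o : List O) (n c m x y z : List Sym) :
    Runs (mv I O) (stk i o (works n c (enc a ++ m) x y z))
      (stk i o (works n c m ((enc a).reverse ++ x) y z)) (2 * (enc a).length)

namespace Data

theorem eval_mono (p : Polynomial ℕ) {a b : ℕ} (h : a ≤ b) : p.eval a ≤ p.eval b := by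
  rw [Polynomial.eval_eq_sum, Polynomial.eval_eq_sum]
  exact Finset.sum_le_sum fun i _ => Nat.mul_le_mul_left _ (Nat.pow_le_pow_left h _)

/-- Letters of size 0 make the size of a binary word equal to its length. -/
noncomputable instance : Data Bool where
  enc b := [some b]
  size _ := 0
  len := 1
  enc_len a := by simp
  mv I O := .pop (.w .top) fun a => .push (.w .x) (a.getD none)
  mv_spec a i o n c m x y z := .mono (.pop (.push _ _ (by simp))) (by simp)

/-- The program that moves the encoding of a number. -/
def mvNat (I O : Type) : Prog I O :=
  .loop (.w .top) (fun a => (a.getD none).isSome) fun a => .push (.w .x) (a.getD none)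

theorem mvNat_spec {I O : Type} (l : List Bool) (i : List I) (o : List O)
    (n c m x y z : List Sym) :
    Runs (mvNat I O) (stk i o (works n c (l.map some ++ [none] ++ m) x y z))
      (stk i o (works n c m ((l.map some ++ [none]).reverse ++ x) y z))
      (2 * (l.map some ++ [none]).length) := by
  induction l generalizing x with
  | nil => exact .mono (.loop_exit (by simp) (.push _ _ (by simp))) (by simp)
  | cons a l ih =>
    refine (Runs.loop_next (by simp) (.push _ _ rfl) ((ih (some a :: x)).congr (by simp) rfl
      le_rfl)).congr rfl (by simp) ?_
    simp only [List.map_cons, List.length_cons, List.cons_append]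
    omega

noncomputable instance : Data ℕ where
  enc a := a.bits.map some ++ [none]
  size := Nat.size
  len := Polynomial.X + 1
  enc_len a := by simp [Nat.size_eq_bits_len]
  mv := mvNat
  mv_spec a := mvNat_spec a.bits

/-- With a maximum instead of a sum, `(a, a)` is no larger than `a`; otherwise copying data inside a
loop could double the size in each round. -/
noncomputable instance {α β : Type} [Data α] [Data β] : Data (α × β) where
  enc a := enc a.1 ++ enc a.2
  size a := max (size a.1) (size a.2)
  len := len α + len β
  enc_len a := by
    simp only [List.length_append, Polynomial.eval_add]
    exact add_le_add ((enc_len _).trans (eval_mono _ (le_max_left _ _)))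
      ((enc_len _).trans (eval_mono _ (le_max_right _ _)))
  mv I O := .seq (mv α I O) (mv β I O)
  mv_spec a i o n c m x y z := by
    have h := (mv_spec a.1 i o n c (enc a.2 ++ m) x y z).seq
      (mv_spec a.2 i o n c m ((enc a.1).reverse ++ x) y z)
    refine cast ?_ (h.mono (le_of_eq (mul_add 2 _ _).symm))
    congr 1 <;> simp

section List

variable {α : Type} [Data α]

/-- The encoding of a list. -/
def encList : List α → List Sym
  | [] => [some false]
  | a :: l => some true :: (enc a ++ encList l)

/-- The maximal size of an entry of a list. -/
def entrySize : List α → ℕ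
  | [] => 0
  | a :: l => max (size a) (entrySize l)

/-- The program that moves the encoding of a list. -/
def mvList (α : Type) [Data α] (I O : Type) : Prog I O :=
  .loop (.w .top) (fun a => (a.getD none).getD false) fun a =>
    if (a.getD none).getD false then .seq (.push (.w .x) (some true)) (mv α I O)
    else .push (.w .x) (some false)

theorem mvList_spec {I O : Type} (l : List α) (i : List I) (o : List O)
    (n c m x y z : List Sym) :
    Runs (mvList α I O) (stk i o (works n c (encList l ++ m) x y z))
      (stk i o (works n c m ((encList l).reverse ++ x) y z)) (2 * (encList l).length) := by
  induction l generalizing x with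
  | nil => exact .mono (.loop_exit (by simp [encList]) (.push _ _ (by simp [encList]))) (by simp [encList])
  | cons a l ih =>
    refine (Runs.loop_next (by simp [encList])
      (.seq (.push _ _ rfl) ((mv_spec a i o n c (encList l ++ m) (some true :: x) y z).congr
        (by simp [encList]) rfl le_rfl)) (ih _)).congr rfl (by simp [encList]) ?_
    simp only [encList, List.length_cons, List.length_append]
    omega

theorem encList_len (l : List α) :
    (encList l).length ≤ l.length * ((len α).eval (entrySize l) + 1) + 1 := by
  induction l with
  | nil => simp [encList]
  | cons a l ih =>
    have h₁ := (enc_len a).trans (eval_mono _ (le_max_left _ (entrySize l)))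
    have h₂ := Nat.mul_le_mul_left l.length
      (Nat.add_le_add_right (eval_mono (len α) (le_max_right (size a) (entrySize l))) 1)
    simp only [encList, List.length_cons, List.length_append, entrySize, Nat.succ_mul]
    omega

noncomputable instance : Data (List α) where
  enc := encList
  size l := max l.length (entrySize l)
  len := Polynomial.X * (len α + 1) + 1
  enc_len l := by
    refine (encList_len l).trans ?_
    simp only [Polynomial.eval_add, Polynomial.eval_mul, Polynomial.eval_X, Polynomial.eval_one]
    gcongr
    · exact le_max_left _ _
    · exact eval_mono _ (le_max_right _ _)
  mv := mvList α
  mv_spec := mvList_spec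

end List

end Data

end NecklaceIndexing

namespace NecklaceIndexing

open Cmd Data

/-! ### Functions computable in polynomial time -/

variable {α β γ : Type} [Data α] [Data β] [Data γ]

/-- `T n a` is bounded by a polynomial in `n` and the size of `a`. -/
def PolyBounded (T : ℕ → α → ℕ) : Prop :=
  ∃ p : Polynomial ℕ, ∀ n a, T n a ≤ p.eval (n + size a)

/-- The function `f` increases sizes by at most a polynomial in the parameter `n`. -/
def GrowsSlowly (f : ℕ → α → β) : Prop :=
  ∃ g : Polynomial ℕ, ∀ n a, size (f n a) ≤ size a + g.eval n

namespace PolyBounded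

theorem const (k : ℕ) : PolyBounded fun _ (_ : α) => k := ⟨Polynomial.C k, by simp⟩

theorem param : PolyBounded fun n (_ : α) => n := ⟨Polynomial.X, by simp⟩

theorem add {T T' : ℕ → α → ℕ} (h : PolyBounded T) (h' : PolyBounded T') :
    PolyBounded fun n a => T n a + T' n a :=
  let ⟨p, hp⟩ := h
  let ⟨p', hp'⟩ := h'
  ⟨p + p', fun n a => by simpa using add_le_add (hp n a) (hp' n a)⟩

theorem mul {T T' : ℕ → α → ℕ} (h : PolyBounded T) (h' : PolyBounded T') :
    PolyBounded fun n a => T n a * T' n a :=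
  let ⟨p, hp⟩ := h
  let ⟨p', hp'⟩ := h'
  ⟨p * p', fun n a => by simpa using Nat.mul_le_mul (hp n a) (hp' n a)⟩

theorem comp {T : ℕ → β → ℕ} {f : ℕ → α → β} (h : PolyBounded T) (hf : GrowsSlowly f) :
    PolyBounded fun n a => T n (f n a) := by
  obtain ⟨p, hp⟩ := h
  obtain ⟨g, hg⟩ := hf
  refine ⟨p.comp (Polynomial.X + g), fun n a => (hp n _).trans ?_⟩
  rw [Polynomial.eval_comp]
  refine eval_mono p ?_
  have h₁ := hg n a
  have h₂ := eval_mono g (Nat.le_add_right n (size a))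
  simp only [Polynomial.eval_add, Polynomial.eval_X]
  omega

theorem enc_length : PolyBounded fun _ (a : α) => (enc a).length :=
  ⟨len α, fun _ a => (enc_len a).trans (eval_mono _ (Nat.le_add_left _ _))⟩

end PolyBounded

namespace GrowsSlowly

theorem comp {f : ℕ → α → β} {g : ℕ → β → γ} (hg : GrowsSlowly g) (hf : GrowsSlowly f) :
    GrowsSlowly fun n a => g n (f n a) := by
  obtain ⟨p, hp⟩ := hf
  obtain ⟨q, hq⟩ := hg
  refine ⟨p + q, fun n a => (hq n _).trans ?_⟩
  simpa [← add_assoc] using hp n a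

theorem pair {f : ℕ → α → β} {g : ℕ → α → γ} (hf : GrowsSlowly f) (hg : GrowsSlowly g) :
    GrowsSlowly fun n a => (f n a, g n a) := by
  obtain ⟨p, hp⟩ := hf
  obtain ⟨q, hq⟩ := hg
  refine ⟨p + q, fun n a => ?_⟩
  have := hp n a
  have := hq n a
  simp only [size, Polynomial.eval_add]
  omega

theorem of_le {f : ℕ → α → β} (k : ℕ) (h : ∀ n a, size (f n a) ≤ size a + k) : GrowsSlowly f :=
  ⟨Polynomial.C k, by simpa using h⟩

theorem iterate_le {f : ℕ → α → α} {g : Polynomial ℕ}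
    (h : ∀ n a, size (f n a) ≤ size a + g.eval n) (n k : ℕ) (a : α) :
    size ((f n)^[k] a) ≤ size a + k * g.eval n := by
  induction k with
  | zero => simp
  | succ k ih =>
    rw [Function.iterate_succ_apply']
    have := h n ((f n)^[k] a)
    rw [Nat.succ_mul]
    omega

end GrowsSlowly

/-- The state of a machine with parameter `n` in unary, loop counters `c` and main stack `m`. -/
def st {I O : Type} (i : List I) (o : List O) (n : ℕ) (c m : List Sym) : State I O :=
  stk i o (works (List.replicate n (some true)) c m [] [] [])

/-- `f n a` is computable by a stack program that replaces `a` on top of the main stack by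
`f n a`, in time polynomial in `n` and the size of `a`, and `f` increases sizes by at most
a polynomial in `n`. -/
def Poly (f : ℕ → α → β) : Prop :=
  GrowsSlowly f ∧ ∀ I O : Type, ∃ (P : Prog I O) (T : ℕ → α → ℕ), PolyBounded T ∧
    ∀ n a (i : List I) (o : List O) (c m : List Sym),
      Runs P (st i o n c (enc a ++ m)) (st i o n c (enc (f n a) ++ m)) (T n a)

/-! ### Rearranging data on the main stack; counted loops -/

section Programs

variable {I O : Type} (i : List I) (o : List O) (n c m x y z l : List Sym)

theorem runs_pour_x_top : Runs (pour .x .top) (stk i o (works n c m x y z))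
    (stk i o (works n c (x.reverse ++ m) [] y z)) (2 * x.length + 2) :=
  (runs_pour i o .x .top (by simp) (works n c m x y z)).congr rfl (by simp) le_rfl

theorem runs_pour_x_y : Runs (pour .x .y) (stk i o (works n c m x y z))
    (stk i o (works n c m [] (x.reverse ++ y) z)) (2 * x.length + 2) :=
  (runs_pour i o .x .y (by simp) (works n c m x y z)).congr rfl (by simp) le_rfl

theorem runs_pour_y_x : Runs (pour .y .x) (stk i o (works n c m x y z))
    (stk i o (works n c m (y.reverse ++ x) [] z)) (2 * y.length + 2) :=
  (runs_pour i o .y .x (by simp) (works n c m x y z)).congr rfl (by simp) le_rfl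

theorem runs_pour_y_z : Runs (pour .y .z) (stk i o (works n c m x y z))
    (stk i o (works n c m x [] (y.reverse ++ z))) (2 * y.length + 2) :=
  (runs_pour i o .y .z (by simp) (works n c m x y z)).congr rfl (by simp) le_rfl

theorem runs_pour_z_top : Runs (pour .z .top) (stk i o (works n c m x y z))
    (stk i o (works n c (z.reverse ++ m) x y [])) (2 * z.length + 2) :=
  (runs_pour i o .z .top (by simp) (works n c m x y z)).congr rfl (by simp) le_rfl

theorem runs_pour_siz_x : Runs (pour .siz .x) (stk i o (works n c m x y z))
    (stk i o (works [] c m (n.reverse ++ x) y z)) (2 * n.length + 2) :=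
  (runs_pour i o .siz .x (by simp) (works n c m x y z)).congr rfl (by simp) le_rfl

theorem runs_clear_x : Runs (clear .x) (stk i o (works n c m x y z))
    (stk i o (works n c m [] y z)) (2 * x.length + 2) :=
  (runs_clear i o .x (works n c m x y z)).congr rfl (by simp) le_rfl

theorem runs_pour₂_top_y : Runs (pour₂ .top .y) (stk i o (works n c m x y z))
    (stk i o (works n c (x.reverse ++ m) [] (x.reverse ++ y) z)) (3 * x.length + 2) :=
  (runs_pour₂ i o .top .y (by simp) (by simp) (by simp) (works n c m x y z)).congr rfl
    (by simp) le_rfl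

theorem runs_pour₂_siz_ctr : Runs (pour₂ .siz .ctr) (stk i o (works n c m x y z))
    (stk i o (works (x.reverse ++ n) (x.reverse ++ c) m [] y z)) (3 * x.length + 2) :=
  (runs_pour₂ i o .siz .ctr (by simp) (by simp) (by simp) (works n c m x y z)).congr rfl
    (by simp) le_rfl

variable (α β) in
/-- Duplicate the datum on top of the main stack. -/
def dup (I O : Type) : Prog I O :=
  .seq (mv α I O) (.seq (pour₂ .top .y) (.seq (pour .y .x) (pour .x .top)))

theorem runs_dup (n : ℕ) (a : α) : Runs (dup α I O) (st i o n c (enc a ++ m))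
    (st i o n c (enc a ++ (enc a ++ m))) (9 * (enc a).length + 6) := by
  refine ((mv_spec a ..).seq ((runs_pour₂_top_y ..).seq
    ((runs_pour_y_x ..).seq (runs_pour_x_top ..)))).congr rfl ?_ ?_
  · simp [st]
  · simp; omega

variable (α β) in
/-- Swap the two data on top of the main stack. -/
def swap (I O : Type) : Prog I O :=
  .seq (mv α I O) (.seq (pour .x .y) (.seq (mv β I O) (.seq (pour .y .z) (.seq (pour .z .top)
    (pour .x .top)))))

theorem runs_swap (n : ℕ) (a : α) (b : β) :
    Runs (swap α β I O) (st i o n c (enc a ++ (enc b ++ m))) (st i o n c (enc b ++ (enc a ++ m)))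
      (8 * (enc a).length + 4 * (enc b).length + 8) := by
  refine ((mv_spec a ..).seq ((runs_pour_x_y ..).seq ((mv_spec b ..).seq
    ((runs_pour_y_z ..).seq ((runs_pour_z_top ..).seq (runs_pour_x_top ..)))))).congr rfl ?_ ?_
  · simp [st]
  · simp; omega

variable (α) in
/-- Remove the datum on top of the main stack. -/
def drop (I O : Type) : Prog I O := .seq (mv α I O) (clear .x)

theorem runs_drop (n : ℕ) (a : α) : Runs (drop α I O) (st i o n c (enc a ++ m))
    (st i o n c m) (4 * (enc a).length + 2) := by
  refine ((mv_spec a ..).seq (runs_clear_x ..)).congr rfl rfl ?_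
  simp; omega

/-- Push a word to the main stack. -/
def write (I O : Type) : List Sym → Prog I O
  | [] => .skip
  | a :: l => .seq (write I O l) (.push (.w .top) a)

theorem runs_write (n : ℕ) (l : List Sym) : Runs (write I O l) (st i o n c m)
    (st i o n c (l ++ m)) (l.length + 1) := by
  induction l with
  | nil => exact .skip _
  | cons a l ih => exact ih.seq (.push _ _ (by simp [st]))

/-- Repeat a program as often as the size parameter says. -/
def repeated (P : Prog I O) : Prog I O :=
  .seq (.push (.w .ctr) none) (.seq (pour .siz .x) (.seq (pour₂ .siz .ctr)
    (.loop (.w .ctr) (fun a => (a.getD none).isSome)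
      fun a => if (a.getD none).isSome then P else .skip)))

/-- Loops can be nested: each puts its own copy of the unary parameter on the counter stack, above a
marker `none`, and its body must work above any content `c` of that stack. The input stack may vary
with `j` so that loops can also read input. -/
theorem runs_repeated {P : Prog I O} (n : ℕ) (i : ℕ → List I) (m : ℕ → List Sym) {T : ℕ}
    (h : ∀ j < n, ∀ c, Runs P (st (i j) o n c (m j)) (st (i (j + 1)) o n c (m (j + 1))) T) :
    Runs (repeated P) (st (i 0) o n c (m 0)) (st (i n) o n c (m n)) (n * (T + 1) + 5 * n + 7) := by
  have main : ∀ k ≤ n, Runs (.loop (.w .ctr) (fun a => (a.getD none).isSome)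
      fun a => if (a.getD none).isSome then P else .skip)
      (st (i (n - k)) o n (List.replicate k (some true) ++ none :: c) (m (n - k)))
      (st (i n) o n c (m n)) (k * (T + 1) + 2) := by
    intro k
    induction k with
    | zero =>
      intro _
      exact (Runs.loop_exit (by simp [st]) (Runs.skip _)).congr rfl (by simp [st]) (by simp)
    | succ k ih =>
      intro hk
      have h₁ := h (n - (k + 1)) (by omega) (List.replicate k (some true) ++ none :: c)
      rw [show n - (k + 1) + 1 = n - k by omega] at h₁
      refine (Runs.loop_next (by simp [st, List.replicate_succ])
        (h₁.congr (by simp [st, List.replicate_succ]) rfl le_rfl) (ih (by omega))).congr rfl rfl ?_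
      rw [Nat.succ_mul]
      omega
  refine ((Runs.push _ _ rfl).seq (((runs_pour_siz_x (i 0) o (List.replicate n (some true))
    (none :: c) (m 0) [] [] []).congr (by simp [st]) rfl le_rfl).seq ((runs_pour₂_siz_ctr ..).seq
    ((main n le_rfl).congr (by simp [st]) rfl le_rfl)))).congr rfl rfl ?_
  simp
  omega

end Programs

/-! ### Closure properties of the functions computable in polynomial time -/

namespace Poly

theorem id : Poly fun _ (a : α) => a :=
  ⟨.of_le 0 fun _ _ => le_rfl, fun _ _ => ⟨.skip, fun _ _ => 1, .const 1, fun _ _ _ _ _ _ =>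
    .skip _⟩⟩

theorem comp {f : ℕ → α → β} {g : ℕ → β → γ} (hg : Poly g) (hf : Poly f) :
    Poly fun n a => g n (f n a) := by
  refine ⟨hg.1.comp hf.1, fun I O => ?_⟩
  obtain ⟨P, T, hT, hP⟩ := hf.2 I O
  obtain ⟨Q, T', hT', hQ⟩ := hg.2 I O
  exact ⟨.seq P Q, _, hT.add (hT'.comp hf.1), fun n a i o c m =>
    (hP n a i o c m).seq (hQ n _ i o c m)⟩

theorem pair {f : ℕ → α → β} {g : ℕ → α → γ} (hf : Poly f) (hg : Poly g) :
    Poly fun n a => (f n a, g n a) := by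
  refine ⟨hf.1.pair hg.1, fun I O => ?_⟩
  obtain ⟨P, T, hT, hP⟩ := hf.2 I O
  obtain ⟨Q, T', hT', hQ⟩ := hg.2 I O
  -- The second component is computed first, from the upper copy; then the other copy is brought to
  -- the top.
  refine ⟨.seq (dup α I O) (.seq Q (.seq (swap γ α I O) P)), _,
    ((PolyBounded.const 9).mul .enc_length |>.add (.const 6)).add (hT'.add
      ((((PolyBounded.const 8).mul (PolyBounded.enc_length.comp hg.1)).add
        ((PolyBounded.const 4).mul .enc_length) |>.add (.const 8)).add hT)),
    fun n a i o c m => ?_⟩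
  exact ((runs_dup ..).seq ((hQ ..).seq ((runs_swap ..).seq
    (hP n a i o c (enc (g n a) ++ m))))).congr rfl (by simp [enc]) le_rfl

theorem fst₀ : Poly fun _ (a : α × β) => a.1 := by
  refine ⟨.of_le 0 fun _ _ => le_max_left _ _, fun I O => ⟨.seq (swap α β I O) (drop β I O), _,
    ((PolyBounded.const 20).mul .enc_length).add (.const 20), fun n a i o c m => ?_⟩⟩
  refine ((runs_swap i o c m n a.1 a.2).seq (runs_drop ..)).congr (by simp [enc]) rfl ?_
  simp only [enc, List.length_append]
  omega

theorem snd₀ : Poly fun _ (a : α × β) => a.2 := by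
  refine ⟨.of_le 0 fun _ _ => le_max_right _ _, fun I O => ⟨drop α I O, _,
    ((PolyBounded.const 20).mul .enc_length).add (.const 20), fun n a i o c m => ?_⟩⟩
  refine (runs_drop i o c (enc a.2 ++ m) n a.1).congr (by simp [enc]) rfl ?_
  simp only [enc, List.length_append]
  omega

theorem fst {f : ℕ → α → β × γ} (hf : Poly f) : Poly fun n a => (f n a).1 := fst₀.comp hf

theorem snd {f : ℕ → α → β × γ} (hf : Poly f) : Poly fun n a => (f n a).2 := snd₀.comp hf

theorem const (b : β) : Poly fun _ (_ : α) => b := by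
  refine ⟨.of_le (size b) fun _ _ => Nat.le_add_left _ _, fun I O =>
    ⟨.seq (drop α I O) (write I O (enc b)), _, (((PolyBounded.const 4).mul .enc_length).add
      (.const 2)).add (.const _), fun n a i o c m => (runs_drop ..).seq (runs_write ..)⟩⟩

theorem ite_aux {p : ℕ → α → Bool} {f g : ℕ → α → β} (hp : Poly p) (hf : Poly f) (hg : Poly g) :
    Poly fun n a => if p n a then f n a else g n a := by
  constructor
  · obtain ⟨q, hq⟩ := hf.1
    obtain ⟨r, hr⟩ := hg.1
    refine ⟨q + r, fun n a => ?_⟩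
    have := hq n a
    have := hr n a
    simp only [Polynomial.eval_add]
    split_ifs <;> omega
  · intro I O
    obtain ⟨P, T, hT, hP⟩ := hp.2 I O
    obtain ⟨Q, T', hT', hQ⟩ := hf.2 I O
    obtain ⟨R, T'', hT'', hR⟩ := hg.2 I O
    refine ⟨.seq (dup α I O) (.seq P (.pop (.w .top) fun a =>
      if (a.getD none).getD false then Q else R)), _,
      ((PolyBounded.const 9).mul .enc_length |>.add (.const 6)).add
        (hT.add ((PolyBounded.const 1).add (hT'.add hT''))), fun n a i o c m => ?_⟩
    refine (runs_dup ..).seq ((hP n a i o c (enc a ++ m)).seq (.pop ?_))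
    cases h : p n a
    · exact (hR n a i o c m).congr (by simp [enc, st]) (by beta_reduce; rw [if_neg (by simp [h])]) (Nat.le_add_left _ _)
    · exact (hQ n a i o c m).congr (by simp [enc, st]) (by beta_reduce; rw [if_pos h]) (Nat.le_add_right _ _)

theorem ite {p : ℕ → α → Prop} [∀ n a, Decidable (p n a)] {f g : ℕ → α → β}
    (hp : Poly fun n a => decide (p n a)) (hf : Poly f) (hg : Poly g) :
    Poly fun n a => if p n a then f n a else g n a := by
  simpa using ite_aux hp hf hg

/-- After at most `n` rounds the size is at most `size a + n * g n`, as each round adds at most `g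
n`. So every round is fast, and the iterate again grows slowly. -/
theorem iterate_id {f : ℕ → α → α} (hf : Poly f) : Poly fun n a => (f n)^[n] a := by
  obtain ⟨g, hg⟩ := hf.1
  have hs := GrowsSlowly.iterate_le hg
  refine ⟨⟨Polynomial.X * g, fun n a => by simpa using hs n n a⟩, fun I O => ?_⟩
  obtain ⟨P, T, ⟨p, hp⟩, hP⟩ := hf.2 I O
  refine ⟨repeated P, fun n a => n * ((p.comp (Polynomial.X + Polynomial.X * g)).eval
    (n + size a) + 1) + 5 * n + 7, ?_, fun n a i o c m => ?_⟩
  · refine ((PolyBounded.param.mul (PolyBounded.add (T := fun n a => _) ⟨_, fun _ _ => le_rfl⟩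
      (.const 1))).add ((PolyBounded.const 5).mul .param)).add (.const 7)
  · refine runs_repeated o c n (fun _ => i) (fun j => enc ((f n)^[j] a) ++ m) fun j hj c => ?_
    have := hP n ((f n)^[j] a) i o c m
    simp only [Function.iterate_succ_apply']
    refine this.mono ((hp n _).trans ?_)
    rw [Polynomial.eval_comp]
    refine eval_mono p ?_
    have h₁ := hs n j a
    have h₂ : j * g.eval n ≤ (n + size a) * g.eval (n + size a) :=
      Nat.mul_le_mul (by omega) (eval_mono g (by omega))
    simp only [Polynomial.eval_add, Polynomial.eval_mul, Polynomial.eval_X]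
    omega

theorem iterate {f : ℕ → γ → α → α} {b : ℕ → γ → α}
    (hf : Poly fun n (q : γ × α) => f n q.1 q.2) (hb : Poly b) :
    Poly fun n c => (f n c)^[n] (b n c) := by
  -- The context `c` is carried through the loop as an unchanged first component.
  have h := ((iterate_id (id.fst.pair hf)).comp (id.pair hb)).snd
  convert h using 3 with n c
  generalize b n c = x
  have : ∀ k, ((fun q : γ × α => (q.1, f n q.1 q.2))^[k] (c, x)) = (c, (f n c)^[k] x) := by
    intro k
    induction k with
    | zero => rfl
    | succ k ih => rw [Function.iterate_succ_apply', ih, Function.iterate_succ_apply']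
  rw [this]

end Poly

end NecklaceIndexing

namespace NecklaceIndexing

open Cmd Data

/-! ### Arithmetic -/

/-- The number with given binary digits, least significant digit first. -/
def val : List Bool → ℕ
  | [] => 0
  | b :: l => b.toNat + 2 * val l

/-- Remove leading zeros, the leading digit being the last one. -/
def strip : List Bool → List Bool
  | [] => []
  | b :: l => if strip l = [] ∧ b = false then [] else b :: strip l

theorem bits_val (l : List Bool) : (val l).bits = strip l := by
  induction l with
  | nil => simp [val, strip]
  | cons b l ih =>
    have hv : val (b :: l) = Nat.bit b (val l) := by
      rw [Nat.bit_val, val]; omega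
    have h0 : strip l = [] ↔ val l = 0 := by
      rw [← ih]
      constructor
      · intro h
        have := Nat.size_eq_bits_len (val l)
        rw [h] at this
        exact Nat.size_eq_zero.1 this.symm
      · intro h; simp [h]
    by_cases h : strip l = [] ∧ b = false
    · rw [hv, strip, if_pos h, h.2, h0.1 h.1]; rfl
    · rw [hv, strip, if_neg h, Nat.bits_append_bit, ih]
      intro hl
      by_contra hb
      exact h ⟨h0.2 hl, by simpa using hb⟩

theorem val_bits (a : ℕ) : val a.bits = a := by
  induction a using Nat.binaryRec' with
  | zero => simp [val]
  | bit b n h ih =>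
    rw [Nat.bits_append_bit _ _ h, val, ih, Nat.bit_val]; omega

theorem val_lt (l : List Bool) : val l < 2 ^ l.length := by
  induction l with
  | nil => simp [val]
  | cons b l ih =>
    have := Bool.toNat_le b
    simp only [val, List.length_cons, pow_succ]
    omega

theorem val_append (l : List Bool) (b : Bool) : val (l ++ [b]) = val l + 2 ^ l.length * b.toNat := by
  induction l with
  | nil => simp [val]
  | cons a l ih =>
    simp only [List.cons_append, val, ih, List.length_cons]
    ring

/-- After a computation the most significant digit is on top of the stack, so popping zeros there
leaves the canonical digits. -/
theorem dropWhile_reverse (l : List Bool) :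
    l.reverse.dropWhile (fun b => b = false) = (strip l).reverse := by
  induction l with
  | nil => simp [strip]
  | cons b l ih =>
    rw [List.reverse_cons, List.dropWhile_append, ih, strip]
    by_cases h : strip l = [] <;> cases b <;> simp [h]

/-- The output and the final state of a letter-to-letter transducer with transition function `f`
reading two words, where a word that has ended is continued by zeros. -/
def transduce (f : Bool → Bool → Bool → Bool × Bool) : Bool → List Bool → List Bool →
    List Bool × Bool
  | c, [], [] => ([], c)
  | c, a :: as, [] =>
    ((f a false c).1 :: (transduce f (f a false c).2 as []).1, (transduce f (f a false c).2 as []).2)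
  | c, [], b :: bs =>
    ((f false b c).1 :: (transduce f (f false b c).2 [] bs).1, (transduce f (f false b c).2 [] bs).2)
  | c, a :: as, b :: bs =>
    ((f a b c).1 :: (transduce f (f a b c).2 as bs).1, (transduce f (f a b c).2 as bs).2)

/-- The transition function of addition with carry. -/
def addStep (a b c : Bool) : Bool × Bool := (xor a (xor b c), (a && b) || (a && c) || (b && c))

/-- The transition function of subtraction with borrow. -/
def subStep (a b c : Bool) : Bool × Bool := (xor a (xor b c), (!a && (b || c)) || (b && c))

/-- The final carry counts as one more digit of the output; this is the invariant of column
addition. -/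
theorem transduce_add (c : Bool) (as bs : List Bool) :
    val (transduce addStep c as bs).1 +
      2 ^ (transduce addStep c as bs).1.length * (transduce addStep c as bs).2.toNat =
    val as + val bs + c.toNat := by
  fun_induction transduce addStep c as bs with
  | case1 c => simp [val]
  | case2 c a as ih =>
    simp only [val, List.length_cons, pow_succ] at ih ⊢
    cases a <;> cases c <;> simp [addStep] at ih ⊢ <;> grind
  | case3 c b bs ih =>
    simp only [val, List.length_cons, pow_succ] at ih ⊢
    cases b <;> cases c <;> simp [addStep] at ih ⊢ <;> grind
  | case4 c a as b bs ih =>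
    simp only [val, List.length_cons, pow_succ] at ih ⊢
    cases a <;> cases b <;> cases c <;> simp [addStep] at ih ⊢ <;> grind

/-- Borrows count negatively. The negative terms are moved across the equation, which avoids
truncated subtraction. -/
theorem transduce_sub (c : Bool) (as bs : List Bool) :
    val (transduce subStep c as bs).1 + val bs + c.toNat =
      val as + 2 ^ (transduce subStep c as bs).1.length * (transduce subStep c as bs).2.toNat := by
  fun_induction transduce subStep c as bs with
  | case1 c => simp [val]
  | case2 c a as ih =>
    simp only [val, List.length_cons, pow_succ] at ih ⊢
    cases a <;> cases c <;> simp [subStep] at ih ⊢ <;> grind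
  | case3 c b bs ih =>
    simp only [val, List.length_cons, pow_succ] at ih ⊢
    cases b <;> cases c <;> simp [subStep] at ih ⊢ <;> grind
  | case4 c a as b bs ih =>
    simp only [val, List.length_cons, pow_succ] at ih ⊢
    cases a <;> cases b <;> cases c <;> simp [subStep] at ih ⊢ <;> grind

theorem transduce_length (f) (c : Bool) (as bs : List Bool) :
    (transduce f c as bs).1.length = max as.length bs.length := by
  fun_induction transduce f c as bs <;> simp_all

/-! ### Transducers as stack programs -/

section Programs

variable {I O : Type} (i : List I) (o : List O) (n ct m x y z : List Sym)

/-- One transition of a transducer whose state is on the stack `z` and whose output goes to `x`. -/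
def transition (I O : Type) (f : Bool → Bool → Bool → Bool × Bool) (a b : Bool) : Prog I O :=
  .pop (.w .z) fun c =>
    let r := f a b ((c.getD none).getD false)
    .seq (.push (.w .x) (some r.1)) (.push (.w .z) (some r.2))

theorem runs_transition (f) (a b c : Bool) :
    Runs (transition I O f a b) (stk i o (works n ct m x y [some c]))
      (stk i o (works n ct m (some (f a b c).1 :: x) y [some (f a b c).2])) 3 :=
  .mono (.pop (.seq (.push _ _ rfl) (.push _ _ (by simp)))) le_rfl

/-- The two phases of the run of a transducer: while the word on the main stack lasts, and
while the word on the stack `y` lasts. -/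
def transduceProg (I O : Type) (f : Bool → Bool → Bool → Bool × Bool) : Prog I O :=
  .seq (.loop (.w .top) (fun b => (b.getD none).isSome) fun b =>
      if (b.getD none).isSome then
        .pop (.w .y) fun a =>
          transition I O f ((a.getD none).getD false) ((b.getD none).getD false)
      else .skip)
    (drain .y fun a => transition I O f (a.getD false) false)

theorem runs_transduceProg (f) (c : Bool) (as bs : List Bool) :
    Runs (transduceProg I O f)
      (stk i o (works n ct (bs.map some ++ none :: m) x (as.map some) [some c]))
      (stk i o (works n ct m ((transduce f c as bs).1.reverse.map some ++ x) []
        [some (transduce f c as bs).2])) (5 * (as.length + bs.length) + 4) := by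
  have key : ∀ (as : List Bool) (c : Bool) (x : List Sym),
      Runs (drain .y fun a => transition I O f (a.getD false) false)
        (stk i o (works n ct m x (as.map some) [some c]))
        (stk i o (works n ct m ((transduce f c as []).1.reverse.map some ++ x) []
          [some (transduce f c as []).2])) (4 * as.length + 2) := by
    intro as
    induction as with
    | nil =>
      exact fun c x => (runs_drain_nil (k := .y) (s := stk i o (works n ct m x [] [some c]))
        rfl).congr rfl (by simp [transduce]) (by simp)
    | cons a as ih =>
      intro c x
      refine (runs_drain_cons rfl ((runs_transition i o n ct m x (as.map some) f a false c).congr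
        (by simp) rfl le_rfl) (ih ..)).congr rfl ?_ ?_
      · simp [transduce]
      · simp; omega
  -- The stacks between the two phases are left existential, so the induction on `bs` needs no
  -- formula for them. Only the total time is bounded.
  suffices h : ∃ s T T', Runs (.loop (.w .top) (fun b => (b.getD none).isSome) fun b =>
      if (b.getD none).isSome then
        .pop (.w .y) fun a =>
          transition I O f ((a.getD none).getD false) ((b.getD none).getD false)
      else .skip) (stk i o (works n ct (bs.map some ++ none :: m) x (as.map some) [some c])) s T ∧
      Runs (drain .y fun a => transition I O f (a.getD false) false) s
        (stk i o (works n ct m ((transduce f c as bs).1.reverse.map some ++ x) []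
          [some (transduce f c as bs).2])) T' ∧ T + T' ≤ 5 * (as.length + bs.length) + 4 by
    obtain ⟨s, T, T', h₁, h₂, hT⟩ := h
    exact (h₁.seq h₂).mono hT
  induction bs generalizing c as x with
  | nil =>
    refine ⟨_, _, _, .loop_exit (by simp) (.skip _), (key as c x).congr (by simp) rfl le_rfl, ?_⟩
    simp; omega
  | cons b bs ih =>
    cases as with
    | nil =>
      obtain ⟨s, T, T', h₁, h₂, hT⟩ := ih (some (f false b c).1 :: x) (f false b c).2 []
      refine ⟨s, _, T', .loop_next (by simp) (.pop ((runs_transition i o n ct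
        (bs.map some ++ none :: m) x [] f false b c).congr (by simp) rfl le_rfl)) h₁,
        h₂.congr rfl (by simp [transduce]) le_rfl, ?_⟩
      simp at hT ⊢; omega
    | cons a as =>
      obtain ⟨s, T, T', h₁, h₂, hT⟩ := ih (some (f a b c).1 :: x) (f a b c).2 as
      refine ⟨s, _, T', .loop_next (by simp) (.pop ((runs_transition i o n ct
        (bs.map some ++ none :: m) x (as.map some) f a b c).congr (by simp) rfl le_rfl)) h₁,
        h₂.congr rfl (by simp [transduce]) le_rfl, ?_⟩
      simp at hT ⊢; omega

/-- Pop zeros from the stack `x`. -/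
def stripProg (I O : Type) : Prog I O :=
  .loop (.w .x) (fun a => a = some (some false)) fun a =>
    if a = some (some false) then .skip else a.elim .skip fun a => .push (.w .x) a

theorem runs_stripProg (l : List Bool) :
    Runs (stripProg I O) (stk i o (works n ct m (l.map some) y z))
      (stk i o (works n ct m ((l.dropWhile (fun b => b = false)).map some) y z))
      (2 * l.length + 2) := by
  induction l with
  | nil => exact (Runs.loop_exit (by simp) (.skip _)).congr rfl (by simp) (by simp)
  | cons b l ih =>
    cases b
    · refine (Runs.loop_next (by simp) (.skip _) (ih.congr (by simp) rfl le_rfl)).congr rfl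
        (by simp) ?_
      simp; omega
    · exact (Runs.loop_exit (by simp) (.push _ _ rfl)).congr rfl (by simp) (by simp)

/-- Write the number whose binary digits, least significant digit at the bottom, are on the stack
`x` to the main stack. -/
def writeNat (I O : Type) : Prog I O :=
  .seq (stripProg I O) (.seq (.push (.w .top) none) (pour .x .top))

theorem strip_length (l : List Bool) : (strip l).length ≤ l.length := by
  induction l with
  | nil => simp [strip]
  | cons b l ih => rw [strip]; split_ifs <;> simp [ih]

theorem runs_writeNat (l : List Bool) :
    Runs (writeNat I O) (stk i o (works n ct m (l.reverse.map some) [] []))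
      (stk i o (works n ct (enc (val l) ++ m) [] [] [])) (4 * l.length + 5) := by
  refine ((runs_stripProg i o n ct m [] [] l.reverse).seq ((Runs.push _ _ rfl).seq
    ((runs_pour_x_top i o n ct (none :: m) ((strip l).reverse.map some) [] []).congr ?_ rfl
      le_rfl))).congr rfl ?_ ?_
  · rw [dropWhile_reverse]; simp
  · simp [enc, bits_val]
  · have := strip_length l
    simp; omega

end Programs

/-- Functions of two numbers that are computed by a transducer, followed by a program depending on
its final state. -/
theorem Poly.of_transducer {g : ℕ × ℕ → ℕ} (f : Bool → Bool → Bool → Bool × Bool)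
    (fin : ∀ I O, Bool → Prog I O) (res : Bool → List Bool → List Bool)
    (hfin : ∀ {I O} (i : List I) (o : List O) (n ct m l c), Runs (fin I O c)
      (stk i o (works n ct m (l.reverse.map some) [] []))
      (stk i o (works n ct m ((res c l).reverse.map some) [] [])) (2 * l.length + 2))
    (hres : ∀ l c, (res c l).length ≤ l.length + 1)
    (hg : ∀ a b, g (a, b) = val (res (transduce f false a.bits b.bits).2
      (transduce f false a.bits b.bits).1))
    (hs : ∀ a b, Nat.size (g (a, b)) ≤ max a.size b.size + 1) :
    Poly fun _ => g := by
  -- Moving the first number leaves its terminator on top of `x`, and the pop discards it. Pouring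
  -- into `y` then puts the least significant digit on top, as the transducer needs.
  refine ⟨.of_le 1 fun n a => hs a.1 a.2, fun I O => ⟨.seq (mv ℕ I O) (.pop (.w .x) fun _ =>
    .seq (pour .x .y) (.seq (.push (.w .z) (some false)) (.seq (transduceProg I O f)
      (.pop (.w .z) fun c => .seq (fin I O ((c.getD none).getD false)) (writeNat I O))))),
    fun _ a => 100 * (enc a).length + 100,
    ((PolyBounded.const 100).mul .enc_length).add (.const 100), fun n a i o ct m => ?_⟩⟩
  obtain ⟨a, b⟩ := a
  set r := transduce f false a.bits b.bits with hr
  have hl : r.1.length = max a.bits.length b.bits.length := transduce_length ..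
  have hl' := hres r.1 r.2
  refine ((mv_spec a i o (List.replicate n (some true)) ct (enc b ++ m) [] [] []).seq (.pop (.seq
    ((runs_pour_x_y i o (List.replicate n (some true)) ct (enc b ++ m) (a.bits.reverse.map some) [] []).congr
      (by simp [enc]) rfl le_rfl) (.seq (.push _ _ rfl) (.seq
      ((runs_transduceProg i o (List.replicate n (some true)) ct m [] f false a.bits b.bits).congr (by simp [enc]) rfl le_rfl)
      (.pop (.seq ((hfin i o (List.replicate n (some true)) ct m r.1 r.2).congr (by simp [← hr]) rfl le_rfl)
        (runs_writeNat i o (List.replicate n (some true)) ct m (res r.2 r.1))))))))).congr ?_ ?_ ?_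
  · simp [st, enc]
  · beta_reduce
    rw [hg]; rfl
  · simp [enc] at hl hl' ⊢
    omega

theorem Poly.add₀ : Poly fun _ (a : ℕ × ℕ) => a.1 + a.2 := by
  refine .of_transducer addStep (fun I O c => .push (.w .x) (some c)) (fun c l => l ++ [c])
    (fun i o n ct m l c => .mono (.push _ _ (by simp)) (by omega)) (by simp) (fun a b => ?_)
    (fun a b => ?_)
  · have := transduce_add false a.bits b.bits
    simp only [val_bits, Bool.toNat_false, add_zero] at this
    rw [val_append, this]
  · rw [Nat.size_le, pow_succ]
    have h₁ := (Nat.lt_size_self a).trans_le (Nat.pow_le_pow_right two_pos (le_max_left _ b.size))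
    have h₂ := (Nat.lt_size_self b).trans_le (Nat.pow_le_pow_right two_pos (le_max_right a.size _))
    omega

theorem Poly.sub₀ : Poly fun _ (a : ℕ × ℕ) => a.1 - a.2 := by
  -- A final borrow means that the true difference is negative; clearing the digits yields the
  -- truncated value 0.
  refine .of_transducer subStep (fun I O c => if c then clear .x else .skip)
    (fun c l => if c then [] else l)
    (fun i o n ct m l c => ?_) (fun l c => ?_) (fun a b => ?_) (fun a b => ?_)
  · cases c
    · exact .mono (.skip _) (by omega)
    · exact (runs_clear_x ..).congr rfl (by simp) (by simp)
  · cases c <;> simp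
  · have := transduce_sub false a.bits b.bits
    have hl := val_lt (transduce subStep false a.bits b.bits).1
    simp only [val_bits, Bool.toNat_false, add_zero] at this
    cases h : (transduce subStep false a.bits b.bits).2
    · simp [h] at this ⊢; omega
    · simp [h, val] at this ⊢; omega
  · exact (Nat.size_le_size (Nat.sub_le _ _)).trans ((le_max_left _ _).trans (Nat.le_succ _))

end NecklaceIndexing

namespace NecklaceIndexing

open Cmd Data

/-! ### Tests, lists and derived loops -/

variable {α β γ δ : Type} [Data α] [Data β] [Data γ] [Data δ]

namespace Poly

theorem add {f g : ℕ → α → ℕ} (hf : Poly f) (hg : Poly g) : Poly fun n a => f n a + g n a :=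
  add₀.comp (hf.pair hg)

theorem sub {f g : ℕ → α → ℕ} (hf : Poly f) (hg : Poly g) : Poly fun n a => f n a - g n a :=
  sub₀.comp (hf.pair hg)

/-- Zero has no digits, so the first symbol of an encoding is the terminator exactly for zero.
Otherwise the remaining digits have to be removed. -/
theorem eq_zero₀ : Poly fun _ (a : ℕ) => decide (a = 0) := by
  refine ⟨.of_le 0 fun _ _ => Nat.zero_le _, fun I O => ⟨.pop (.w .top) fun b =>
    if (b.getD none).isSome then .seq (mvNat I O) (.seq (clear .x) (write I O [some false]))
    else write I O [some true], fun _ a => 4 * (enc a).length + 10,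
    ((PolyBounded.const 4).mul .enc_length).add (.const 10), fun n a i o c m => ?_⟩⟩
  rcases hb : a.bits with _ | ⟨b, l⟩
  · have ha : a = 0 := by
      have := val_bits a
      rw [hb] at this
      exact this.symm
    subst ha
    exact (Runs.pop ((runs_write i o c m n [some true]).congr (by simp [enc, st])
      (by simp [enc]) le_rfl)).mono (by simp)
  · have ha : a ≠ 0 := by
      rintro rfl
      simp at hb
    have h := ((mvNat_spec l i o (List.replicate n (some true)) c m [] [] []).seq
      ((runs_clear_x ..).seq (runs_write i o c m n [some false]))).congr rfl
        (show _ = st i o n c (enc (decide (a = 0)) ++ m) by simp [enc, ha]) le_rfl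
    have henc : enc a = some b :: (l.map some ++ [none]) := by simp [enc, hb]
    rw [henc]
    refine (Runs.pop ((h.congr ?_ rfl le_rfl))).mono ?_
    · simp [st]
    · simp [henc]
      omega

theorem eq_zero {f : ℕ → α → ℕ} (hf : Poly f) : Poly fun n a => decide (f n a = 0) :=
  eq_zero₀.comp hf

theorem le {f g : ℕ → α → ℕ} (hf : Poly f) (hg : Poly g) :
    Poly fun n a => decide (f n a ≤ g n a) := by
  simpa only [Nat.sub_eq_zero_iff_le] using (hf.sub hg).eq_zero

theorem bool {p q : ℕ → α → Bool} (f : Bool → Bool → Bool) (hp : Poly p) (hq : Poly q) :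
    Poly fun n a => f (p n a) (q n a) := by
  convert hp.ite_aux (hq.ite_aux (const (f true true)) (const (f true false)))
    (hq.ite_aux (const (f false true)) (const (f false false))) using 3 with n a
  cases p n a <;> cases q n a <;> rfl

theorem not {p : ℕ → α → Bool} (hp : Poly p) : Poly fun n a => !p n a :=
  hp.bool (fun b _ => !b) hp

theorem lt {f g : ℕ → α → ℕ} (hf : Poly f) (hg : Poly g) :
    Poly fun n a => decide (f n a < g n a) := by
  simpa only [← decide_not, not_le] using (hg.le hf).not

theorem cons₀ : Poly fun _ (a : α × List α) => a.1 :: a.2 := by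
  refine ⟨.of_le 1 fun n a => ?_, fun I O => ⟨.push (.w .top) (some true), fun _ _ => 1, .const 1,
    fun n a i o c m => .push _ _ (by simp [enc, encList, st])⟩⟩
  simp only [size, entrySize, List.length_cons]
  omega

theorem cons {f : ℕ → α → β} {g : ℕ → α → List β} (hf : Poly f) (hg : Poly g) :
    Poly fun n a => f n a :: g n a := cons₀.comp (hf.pair hg)

theorem uncons (d : α) : Poly fun _ (l : List α) => (l.headD d, l.tail) := by
  refine ⟨.of_le (size d) fun n a => ?_, fun I O => ⟨.pop (.w .top) fun b =>
    if (b.getD none).getD false then .skip else .seq (.push (.w .top) (some false))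
      (write I O (enc d)), _, .const ((enc d).length + 3), fun n a i o c m => ?_⟩⟩
  · cases a <;> simp [size, entrySize]
    omega
  · cases a with
    | nil =>
      exact (Runs.pop ((Runs.push _ _ rfl).seq ((runs_write i o c
        ([some false] ++ m) n (enc d)).congr (by simp [st, enc, encList]) rfl le_rfl))).congr rfl
        (by simp [enc, encList]) (by omega)
    | cons a l =>
      exact (Runs.pop (.skip _)).congr rfl (by simp [enc, encList, st]) (by omega)

theorem headD {f : ℕ → α → List β} (hf : Poly f) (d : β) : Poly fun n a => (f n a).headD d :=
  ((uncons d).comp hf).fst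

theorem tail [Inhabited β] {f : ℕ → α → List β} (hf : Poly f) : Poly fun n a => (f n a).tail :=
  ((uncons default).comp hf).snd

theorem isEmpty₀ : Poly fun _ (l : List α) => l.isEmpty := by
  refine ⟨.of_le 0 fun _ _ => Nat.zero_le _, fun I O => ⟨.pop (.w .top) fun b =>
    if (b.getD none).getD false then .seq (drop α I O) (.seq (drop (List α) I O)
      (write I O [some false])) else write I O [some true], fun _ a => 4 * (enc a).length + 20,
    ((PolyBounded.const 4).mul .enc_length).add (.const 20), fun n a i o c m => ?_⟩⟩
  cases a with
  | nil =>
    exact (Runs.pop ((runs_write i o c m n [some true]).congr (by simp [enc, encList, st])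
      rfl le_rfl)).congr rfl (by simp [enc]) (by simp)
  | cons a l =>
    refine (Runs.pop (((runs_drop i o c (encList l ++ m) n a).congr (by simp [st, enc, encList]) rfl
      le_rfl).seq ((runs_drop i o c m n l).seq (runs_write i o c m n [some false])))).congr rfl
      (by simp [enc]) ?_
    simp [enc, encList]
    omega

theorem isEmpty {f : ℕ → α → List β} (hf : Poly f) : Poly fun n a => (f n a).isEmpty :=
  isEmpty₀.comp hf

/-- Left folds over the first elements of a list, as many as the parameter says. -/
theorem foldl_take [Inhabited β] {f : ℕ → γ → α → β → α} {b : ℕ → γ → α} {l : ℕ → γ → List β}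
    (hf : Poly fun n (q : γ × α × β) => f n q.1 q.2.1 q.2.2) (hb : Poly b) (hl : Poly l) :
    Poly fun n c => ((l n c).take n).foldl (f n c) (b n c) := by
  have step : Poly fun n (q : γ × α × List β) =>
      if q.2.2.isEmpty then q.2 else (f n q.1 q.2.1 (q.2.2.headD default), q.2.2.tail) :=
    id.snd.snd.isEmpty.ite_aux id.snd
      ((hf.comp (id.fst.pair (id.snd.fst.pair (id.snd.snd.headD default)))).pair id.snd.snd.tail)
  convert (iterate (f := fun n c (s : α × List β) => if s.2.isEmpty then s else
    (f n c s.1 (s.2.headD default), s.2.tail)) step (hb.pair hl)).fst using 3 with n c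
  generalize b n c = x
  generalize l n c = l
  have key : ∀ (k : ℕ) (l : List β) (x : α), (l.take k).foldl (f n c) x =
      ((fun s : α × List β => if s.2.isEmpty then s else
        (f n c s.1 (s.2.headD default), s.2.tail))^[k] (x, l)).1 := by
    intro k
    induction k with
    | zero => simp
    | succ k ih =>
      intro l x
      rw [Function.iterate_succ_apply]
      cases l with
      | nil => simpa using ih [] x
      | cons a l => simpa using ih l (f n c x a)
  exact key n l x

theorem param : Poly fun n (_ : α) => n := by
  convert iterate (f := fun _ (_ : α) (k : ℕ) => k + 1) (id.snd.add (const 1)) (const 0)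
    using 3 with n
  simp

end Poly

end NecklaceIndexing

namespace NecklaceIndexing

/-! ### The algorithms -/

/-- One step of the evaluation of a scalar product: the state consists of the remaining letters
and the partial sum. -/
def dotStep (s : List Bool × ℕ) (f : ℕ) : List Bool × ℕ :=
  (s.1.tail, s.2 + if s.1.headD true then 0 else f)

/-- The next entry of the table of the numbers of closed walks, from the word `x`, the index `g`
of the entry and the list `fs` of previous entries. -/
def tableEntry (n : ℕ) (x : List Bool) (g : ℕ) (fs : List ℕ) : ℕ :=
  let s := (fs.take n).foldl dotStep (x, 0)
  s.2 + if s.1.headD true then 0 else g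

/-- The table of the numbers of closed walks for the lengths `n, …, 1`. -/
def table (n : ℕ) (x : List Bool) : List ℕ :=
  ((fun s : ℕ × List ℕ => (s.1 + 1, tableEntry n x (s.1 + 1) s.2 :: s.2))^[n] (0, [])).2

/-- One step of the subtractive Euclidean algorithm. -/
def gcdStep (s : ℕ × ℕ) : ℕ × ℕ :=
  if s.1 = 0 then s else if s.1 ≤ s.2 then (s.1, s.2 - s.1) else (s.2, s.1 - s.2)

/-- The greatest common divisor of two numbers that are at most `n`. -/
def gcdN (n a b : ℕ) : ℕ := ((fun s => gcdStep (gcdStep s))^[n] (a, b)).2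

/-- Remove the first `min k n` elements of a list. -/
def dropN {α : Type} (n k : ℕ) (l : List α) : List α :=
  ((fun s : ℕ × List α => if s.1 = 0 then s else (s.1 - 1, s.2.tail))^[n] (k, l)).2

/-- The sum of the numbers of closed walks of lengths `gcd i n`, for `i = 1, …, n`. -/
def walkSum (n : ℕ) (x : List Bool) : ℕ :=
  ((fun s : ℕ × ℕ => (s.1 + 1, s.2 +
    (dropN n (n - gcdN n (s.1 + 1) n) (table n x)).headD 0))^[n] (0, 0)).2

/-- One step of a lexicographic comparison: the state consists of the remaining letters of the
second word and of the truth values of "equal so far" and "less". -/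
def ltStep (s : List Bool × Bool × Bool) (a : Bool) : List Bool × Bool × Bool :=
  (s.1.tail, s.2.1 && (a == s.1.headD false), s.2.2 || (s.2.1 && (!a && s.1.headD false)))

/-- Whether the word `t` is less than the prefix of `y` of the same length. -/
def ltPrefix (n : ℕ) (t y : List Bool) : Bool := ((t.take n).foldl ltStep (y, true, false)).2.2

/-- Whether no suffix of `y` is less than the prefix of `y` of the same length. -/
def isPre (n : ℕ) (y : List Bool) : Bool :=
  ((fun s : List Bool × Bool => (s.1.tail, s.2 && !ltPrefix n s.1 y))^[n] (y, true)).2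

/-- Reverse `u` and append `v`. -/
def revAppend (n : ℕ) (u v : List Bool) : List Bool := (u.take n).foldl (fun acc a => a :: acc) v

/-- The candidate word that continues the reversed prefix `u` by a zero and then by ones. -/
def candidate (n : ℕ) (ones u : List Bool) : List Bool := revAppend n (false :: u) ones.tail

/-- Whether the word with (multiplied) index `nj` is greater than `y`. -/
def chooseOne (n nj : ℕ) (y : List Bool) : Bool := !(isPre n y && decide (walkSum n y < nj))

/-- One step of the search for the word with (multiplied) index `nj`. -/
def searchStep (n nj : ℕ) (s : List Bool × List Bool) : List Bool × List Bool :=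
  (s.1.tail, chooseOne n nj (candidate n s.1 s.2) :: s.2)

/-- The search for the word with (multiplied) index `nj`. -/
def search (n nj : ℕ) : List Bool :=
  revAppend n ((searchStep n nj)^[n] ((fun l => true :: l)^[n] [], [])).2 []

/-- Whether the index `j` is too large. -/
def tooLarge (n j : ℕ) : Bool :=
  decide (n + walkSum n ((fun l => false :: l)^[n] []) < (fun k => k + j)^[n] 0) ||
    (decide (n = 0) && decide (1 < j))

/-- The indexing algorithm. -/
def indexing (n j : ℕ) : Option (List Bool) :=
  if tooLarge n j then none else some (search n ((fun k => k + j)^[n] 0))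

/-- Rotation of a word by one letter. -/
def rotate₁ (n : ℕ) (y : List Bool) : List Bool :=
  revAppend n (y.headD false :: revAppend n y.tail []) []

/-- One step of the computation of the (multiplied) rank of a necklace. -/
def rankStep (n : ℕ) (s : List Bool × ℕ) : List Bool × ℕ :=
  (rotate₁ n s.1,
    if isPre n s.1 && decide (s.2 < walkSum n s.1) then walkSum n s.1 else s.2)

/-- The list of `(2 ^ i * n, 2 ^ i)` for `i = n - 1, …, 0`. -/
def powerList (n : ℕ) : List (ℕ × ℕ) :=
  ((fun s : (ℕ × ℕ) × List (ℕ × ℕ) =>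
    ((s.1.1 + s.1.1, s.1.2 + s.1.2), s.1 :: s.2))^[n] ((n, 1), [])).2

/-- One step of long division. -/
def divStep (s : ℕ × ℕ) (p : ℕ × ℕ) : ℕ × ℕ :=
  if p.1 ≤ s.1 then (s.1 - p.1, s.2 + p.2) else s

/-- Division by `n`. -/
def divN (n a : ℕ) : ℕ := (((powerList n).take n).foldl divStep (a, 0)).2

/-- The reverse indexing algorithm. -/
def reverseIndexing (n : ℕ) (y : List Bool) : ℕ := divN n ((rankStep n)^[n] (y, 0)).2 + 1

/-! ### The algorithms run in polynomial time -/

section Poly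

open NecklaceIndexing.Poly

variable {α : Type} [Data α]

theorem poly_tableEntry : Poly fun n (q : List Bool × ℕ × List ℕ) =>
    tableEntry n q.1 q.2.1 q.2.2 := by
  have h₁ : Poly fun (_ : ℕ) (q : (List Bool × ℕ × List ℕ) × (List Bool × ℕ) × ℕ) =>
      dotStep q.2.1 q.2.2 :=
    id.snd.fst.fst.tail.pair (id.snd.fst.snd.add
      ((id.snd.fst.fst.headD true).ite_aux (const 0) id.snd.snd))
  have h₂ := foldl_take (f := fun _ _ => dotStep) h₁ (id.fst.pair (const 0)) id.snd.snd
  exact h₂.snd.add ((h₂.fst.headD true).ite_aux (const 0) id.snd.fst)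

theorem poly_table : Poly table := by
  have h : Poly fun n (q : List Bool × ℕ × List ℕ) =>
      (q.2.1 + 1, tableEntry n q.1 (q.2.1 + 1) q.2.2 :: q.2.2) :=
    (id.snd.fst.add (const 1)).pair ((poly_tableEntry.comp
      (id.fst.pair ((id.snd.fst.add (const 1)).pair id.snd.snd))).cons id.snd.snd)
  exact (iterate (f := fun n x s => (s.1 + 1, tableEntry n x (s.1 + 1) s.2 :: s.2)) h
    (const (0, []))).snd

theorem poly_gcdN {f g : ℕ → α → ℕ} (hf : Poly f) (hg : Poly g) :
    Poly fun n a => gcdN n (f n a) (g n a) := by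
  have h : Poly fun _ => gcdStep :=
    ite id.fst.eq_zero id ((id.fst.le id.snd).ite (id.fst.pair (id.snd.sub id.fst))
      (id.snd.pair (id.fst.sub id.snd)))
  exact (iterate (f := fun _ _ s => gcdStep (gcdStep s)) ((h.comp h).comp id.snd)
    (hf.pair hg)).snd

theorem poly_dropN {β : Type} [Data β] [Inhabited β] {f : ℕ → α → ℕ} {g : ℕ → α → List β}
    (hf : Poly f) (hg : Poly g) : Poly fun n a => dropN n (f n a) (g n a) := by
  have h : Poly fun (_ : ℕ) (q : α × ℕ × List β) =>
      if q.2.1 = 0 then q.2 else (q.2.1 - 1, q.2.2.tail) :=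
    ite id.snd.fst.eq_zero id.snd ((id.snd.fst.sub (const 1)).pair id.snd.snd.tail)
  exact (iterate (f := fun _ _ s => if s.1 = 0 then s else (s.1 - 1, s.2.tail)) h
    (hf.pair hg)).snd

theorem poly_walkSum : Poly walkSum := by
  have h : Poly fun n (q : List Bool × ℕ × ℕ) => (q.2.1 + 1, q.2.2 +
      (dropN n (n - gcdN n (q.2.1 + 1) n) (table n q.1)).headD 0) :=
    (id.snd.fst.add (const 1)).pair (id.snd.snd.add ((poly_dropN
      (param.sub (poly_gcdN (id.snd.fst.add (const 1)) param)) (poly_table.comp id.fst)).headD 0))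
  exact (iterate (f := fun n x s => (s.1 + 1, s.2 +
    (dropN n (n - gcdN n (s.1 + 1) n) (table n x)).headD 0)) h (const (0, 0))).snd

theorem poly_ltPrefix : Poly fun n (q : List Bool × List Bool) => ltPrefix n q.1 q.2 := by
  have h : Poly fun (_ : ℕ) (q : (List Bool × List Bool) × (List Bool × Bool × Bool) × Bool) =>
      ltStep q.2.1 q.2.2 :=
    id.snd.fst.fst.tail.pair ((id.snd.fst.snd.fst.bool (· && ·)
      (id.snd.snd.bool (· == ·) (id.snd.fst.fst.headD false))).pair
      (id.snd.fst.snd.snd.bool (· || ·) (id.snd.fst.snd.fst.bool (· && ·)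
        (id.snd.snd.bool (fun a b => !a && b) (id.snd.fst.fst.headD false)))))
  exact (foldl_take (f := fun _ _ => ltStep) h (id.snd.pair (const (true, false))) id.fst).snd.snd

theorem poly_isPre : Poly isPre := by
  have h : Poly fun n (q : List Bool × List Bool × Bool) =>
      (q.2.1.tail, q.2.2 && !ltPrefix n q.2.1 q.1) :=
    id.snd.fst.tail.pair (id.snd.snd.bool (fun a b => a && !b)
      (poly_ltPrefix.comp (id.snd.fst.pair id.fst)))
  exact (iterate (f := fun n y s => (s.1.tail, s.2 && !ltPrefix n s.1 y)) h
    (id.pair (const true))).snd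

theorem poly_revAppend {f g : ℕ → α → List Bool} (hf : Poly f) (hg : Poly g) :
    Poly fun n a => revAppend n (f n a) (g n a) :=
  foldl_take (f := fun _ (_ : α) acc a => a :: acc) (id.snd.snd.cons id.snd.fst) hg hf

theorem poly_search : Poly search := by
  have h₁ : Poly fun n (q : ℕ × List Bool × List Bool) => candidate n q.2.1 q.2.2 :=
    poly_revAppend ((const false).cons id.snd.snd) id.snd.fst.tail
  have h₂ : Poly fun n (q : ℕ × List Bool × List Bool) =>
      chooseOne n q.1 (candidate n q.2.1 q.2.2) :=
    ((poly_isPre.comp h₁).bool (· && ·) ((poly_walkSum.comp h₁).lt id.fst)).not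
  have h₃ : Poly fun (_ : ℕ) (q : ℕ × List Bool) => true :: q.2 := (const true).cons id.snd
  exact poly_revAppend (iterate (f := searchStep) (id.snd.fst.tail.pair (h₂.cons id.snd.snd))
    ((iterate (f := fun _ _ l => true :: l) h₃ (const [])).pair (const []))).snd (const [])

theorem poly_mul : Poly fun n (j : ℕ) => (fun k => k + j)^[n] 0 :=
  iterate (f := fun _ j k => k + j) (id.snd.add id.fst) (const 0)

theorem poly_tooLarge : Poly tooLarge := by
  have h : Poly fun (_ : ℕ) (q : ℕ × List Bool) => false :: q.2 := (const false).cons id.snd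
  exact ((param.add (poly_walkSum.comp (iterate (f := fun _ _ l => false :: l) h
    (const [])))).lt poly_mul).bool (· || ·)
      (param.eq_zero.bool (· && ·) ((const 1).lt id))

theorem poly_search_mul : Poly fun n j => search n ((fun k => k + j)^[n] 0) :=
  poly_search.comp poly_mul

theorem poly_rotate₁ : Poly rotate₁ :=
  poly_revAppend ((id.headD false).cons (poly_revAppend id.tail (const []))) (const [])

theorem poly_powerList : Poly fun n (_ : α) => powerList n := by
  have h : Poly fun (_ : ℕ) (q : α × (ℕ × ℕ) × List (ℕ × ℕ)) =>
      ((q.2.1.1 + q.2.1.1, q.2.1.2 + q.2.1.2), q.2.1 :: q.2.2) :=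
    ((id.snd.fst.fst.add id.snd.fst.fst).pair (id.snd.fst.snd.add id.snd.fst.snd)).pair
      (id.snd.fst.cons id.snd.snd)
  exact (iterate (f := fun _ _ (s : (ℕ × ℕ) × List (ℕ × ℕ)) =>
    ((s.1.1 + s.1.1, s.1.2 + s.1.2), s.1 :: s.2)) h
    ((param.pair (const 1)).pair (const []))).snd

theorem poly_divN : Poly divN := by
  have h : Poly fun (_ : ℕ) (q : ℕ × (ℕ × ℕ) × ℕ × ℕ) => divStep q.2.1 q.2.2 :=
    (id.snd.snd.fst.le id.snd.fst.fst).ite ((id.snd.fst.fst.sub id.snd.snd.fst).pair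
      (id.snd.fst.snd.add id.snd.snd.snd)) id.snd.fst
  exact (foldl_take (f := fun _ _ => divStep) h (id.pair (const 0)) poly_powerList).snd

theorem poly_reverseIndexing : Poly reverseIndexing := by
  have h : Poly rankStep :=
    (poly_rotate₁.comp id.fst).pair
      (((poly_isPre.comp id.fst).bool (· && ·) (id.snd.lt (poly_walkSum.comp id.fst))).ite_aux
        (poly_walkSum.comp id.fst) id.snd)
  exact (poly_divN.comp (iterate (f := fun n _ s => rankStep n s) (h.comp id.snd)
    (id.pair (const 0))).snd).add (const 1)

end Poly

end NecklaceIndexing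

namespace NecklaceIndexing

open Cmd Data

/-! ### Input and output -/

theorem update_nil_inp {I O : Type} (w : List I) :
    Function.update (fun k => ([] : List (Alph I O k))) .inp w =
      stk w [] (works [] [] [] [] [] []) := by
  funext k
  rcases k with _ | _ | k
  · simp
  · simp
  · cases k <;> simp

theorem Runs.computable {X Y I O : Type} [Fintype I] [Fintype O] {ea : X → List I}
    {eb : Y → List O} {f : X → Y} {time : X → ℕ} (P : Prog I O)
    (h : ∀ x, ∃ g, Runs P (stk (ea x) [] (works [] [] [] [] [] [])) g (time x) ∧
      g .out = eb (f x)) :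
    ComputableInTime ea eb f fun x => time x + 1 := by
  refine ⟨⟨toTM2 P .inp .out, Equiv.refl _, Equiv.refl _⟩, fun x => ?_⟩
  obtain ⟨g, ⟨t, ht, hE⟩, hg⟩ := h x
  rw [← update_nil_inp] at hE
  have := hE.haltsWithOutput (k₁ := .out) (T := time x + 1) (by omega)
  rw [hg] at this
  have e₁ : List.map (fun a : I => a) (ea x) = ea x := List.map_id' _
  have e₂ : List.map (fun a : O => a) (eb (f x)) = eb (f x) := List.map_id' _
  exact (congrArg₂ (fun u v => HaltsWithOutput (toTM2 P .inp .out) u v (time x + 1)) e₁ e₂).mpr this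

/-! ### Words as input, binary numbers as output -/

section Reverse

variable (i : List Bool) (o : List Bool) (n c m x y z : List Sym)

/-- Read a binary word, and set the size parameter to its length. -/
def readWord : Prog Bool Bool :=
  .seq (.loop .inp Option.isSome fun b => b.elim .skip fun b =>
    .seq (.push (.w .siz) (some true)) (.push (.w .x) (some b)))
    (.seq (.push (.w .top) (some false))
      (drain .x fun a => .seq (.push (.w .top) a) (.push (.w .top) (some true))))

theorem runs_readWord (w : List Bool) :
    Runs readWord (stk w [] (works [] [] [] [] [] [])) (st [] [] w.length [] (enc w))
      (6 * w.length + 5) := by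
  have h₁ : ∀ (w : List Bool) (n : List Sym) (x : List Sym),
      Runs (.loop .inp Option.isSome fun b => b.elim .skip fun b =>
        .seq (.push (.w .siz) (some true)) (.push (.w .x) (some b)) : Prog Bool Bool)
      (stk w [] (works n [] [] x [] []))
      (stk [] [] (works (List.replicate w.length (some true) ++ n) [] []
        (w.reverse.map some ++ x) [] [])) (3 * w.length + 2) := by
    intro w
    induction w with
    | nil =>
      intro n x
      exact (Runs.loop_exit (by simp) (.skip _)).congr rfl (by simp) (by simp)
    | cons b w ih =>
      intro n x
      refine (Runs.loop_next (by simp) (.seq (.push _ _ rfl) (.push _ _ rfl))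
        ((ih (some true :: n) (some b :: x)).congr (by simp) rfl le_rfl)).congr rfl ?_ ?_
      · simp [List.replicate_succ', List.append_assoc]
      · simp; omega
  have h₂ : ∀ (w : List Bool) (n m : List Sym),
      Runs (drain .x fun a => .seq (.push (.w .top) a) (.push (.w .top) (some true)) :
        Prog Bool Bool)
      (stk [] [] (works n [] m (w.map some) [] []))
      (stk [] [] (works n [] ((w.reverse.flatMap fun b => [some true, some b]) ++ m) [] [] []))
      (3 * w.length + 2) := by
    intro w
    induction w with
    | nil =>
      intro n m
      exact (runs_drain_nil (k := .x) rfl).congr rfl (by simp) (by simp)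
    | cons b w ih =>
      intro n m
      refine (runs_drain_cons rfl (.seq (.push _ _ rfl) (.push _ _ rfl))
        ((ih n (some true :: some b :: m)).congr (by simp) rfl le_rfl)).congr rfl ?_ ?_
      · simp
      · simp; omega
  have h₃ : ∀ w : List Bool, enc w = (w.flatMap fun b => [some true, some b]) ++ [some false] := by
    intro w
    induction w with
    | nil => rfl
    | cons b w ih =>
      rw [List.flatMap_cons, List.append_assoc, ← ih]
      rfl
  refine ((h₁ w [] []).seq ((Runs.push _ _ rfl).seq
    ((h₂ w.reverse (List.replicate w.length (some true)) [some false]).congr (by simp) rfl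
      le_rfl))).congr rfl ?_ ?_
  · simp [st, h₃]
  · simp; omega

/-- Output the binary digits of a number. -/
noncomputable def outputNat : Prog Bool Bool :=
  .seq (mv ℕ Bool Bool) (.pop (.w .x) fun _ => drain .x fun a => .push .out (a.getD false))

theorem runs_outputNat (n a : ℕ) :
    Runs outputNat (st [] [] n [] (enc a))
      (stk [] a.bits (works (List.replicate n (some true)) [] [] [] [] []))
      (4 * (enc a).length + 3) := by
  have h : ∀ (l : List Bool) (n : List Sym) (o : List Bool),
      Runs (drain .x fun a => .push .out (a.getD false) : Prog Bool Bool)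
      (stk [] o (works n [] [] (l.map some) [] []))
      (stk [] (l.reverse ++ o) (works n [] [] [] [] [])) (2 * l.length + 2) := by
    intro l
    induction l with
    | nil =>
      intro n o
      exact (runs_drain_nil (k := .x) rfl).congr rfl (by simp) (by simp)
    | cons b l ih =>
      intro n o
      refine (runs_drain_cons rfl (.push _ _ rfl) ((ih n (b :: o)).congr (by simp) rfl
        le_rfl)).congr rfl ?_ ?_
      · simp
      · simp; omega
  refine ((mv_spec a [] [] (List.replicate n (some true)) [] [] [] [] []).seq (.pop
    ((h a.bits.reverse (List.replicate n (some true)) []).congr ?_ rfl le_rfl))).congr ?_ ?_ ?_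
  · simp [enc]
  · simp [st]
  · simp
  · simp [enc]; omega

theorem computable_of_poly {f : ℕ → List Bool → ℕ} (hf : Poly f) :
    ∃ p : Polynomial ℕ, ComputableInTime (fun s : List Bool => s) Nat.bits
      (fun s => f s.length s) (fun s => p.eval s.length) := by
  obtain ⟨P, T, hT, hP⟩ := hf.2 Bool Bool
  obtain ⟨p, hp⟩ : PolyBounded fun n (a : List Bool) => 6 * n + 5 + (T n a +
    (4 * (enc (f n a)).length + 3)) :=
    (((PolyBounded.const 6).mul .param).add (.const 5)).add (hT.add
      (((PolyBounded.const 4).mul (PolyBounded.enc_length.comp hf.1)).add (.const 3)))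
  have hsize : ∀ w : List Bool, size w = w.length := by
    have h₀ : ∀ w : List Bool, entrySize w = 0 := fun w => by
      induction w with
      | nil => rfl
      | cons b w ih => simp [entrySize, ih, size]
    intro w
    simp [size, h₀]
  -- Parameter and size of the datum both equal the length of the word, so `p` is evaluated at twice
  -- the length.
  refine ⟨p.comp (2 * Polynomial.X) + 1, ?_⟩
  have := Runs.computable (ea := fun s : List Bool => s) (eb := Nat.bits)
    (f := fun s => f s.length s) (time := fun s => (p.comp (2 * Polynomial.X)).eval s.length)
    (.seq readWord (.seq P outputNat)) fun w => ⟨_, ((runs_readWord w).seq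
      (((hP w.length w [] [] [] []).congr (by simp) rfl le_rfl).seq
        ((runs_outputNat w.length (f w.length w)).congr (by simp) rfl le_rfl))).mono ?_, rfl⟩
  · simpa using this
  · refine (hp _ _).trans (le_of_eq ?_)
    rw [Polynomial.eval_comp, hsize]
    congr 1
    simp; omega

end Reverse

/-! ### Unary parameter with binary index as input, words as output -/

section Index

variable (i : List (Option Bool)) (o : List (Option Bool)) (n c m x y z : List Sym)

/-- Read a unary number to the stack `siz`, and one more symbol. -/
def readTally : Prog (Option Bool) (Option Bool) :=
  .loop .inp (fun a => a = some none) fun a => a.elim .skip fun a =>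
    a.elim (.push (.w .siz) (some true)) fun b => .push (.w .top) (some b)

/-- The end of the tally marks is noticed only by popping the first digit, if there is one, which is
therefore saved. With `n` further reads this makes `n + 1` digits. -/
theorem runs_readTally (k : ℕ) (l : List Bool) (n : List Sym) :
    Runs readTally (stk (List.replicate k none ++ l.map some) [] (works n [] [] [] [] []))
      (stk ((l.drop 1).map some) [] (works (List.replicate k (some true) ++ n) []
        ((l.take 1).reverse.map some) [] [] [])) (2 * k + 2) := by
  induction k generalizing n with
  | zero =>
    cases l with
    | nil => exact (Runs.loop_exit (by simp) (.skip _)).congr rfl (by simp) (by simp)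
    | cons b l => exact (Runs.loop_exit (by simp) (.push _ _ rfl)).congr rfl (by simp) (by simp)
  | succ k ih =>
    rw [List.replicate_succ, List.cons_append]
    refine (Runs.loop_next (by simp) (.push _ _ rfl)
      ((ih (some true :: n)).congr (by simp) rfl le_rfl)).congr rfl ?_ ?_
    · simp [List.replicate_succ', List.append_assoc]
    · omega

/-- Read one binary digit, if there is one. -/
def readBit : Prog (Option Bool) (Option Bool) :=
  .pop .inp fun a => a.elim .skip fun a => .push (.w .top) a

theorem runs_readBits (n k : ℕ) (l : List Bool) :
    Runs (repeated readBit)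
      (st ((l.drop k).map some) [] n [] ((l.take k).reverse.map some))
      (st ((l.drop (k + n)).map some) [] n [] ((l.take (k + n)).reverse.map some))
      (n * 3 + 5 * n + 7) := by
  refine runs_repeated [] [] n (fun j => (l.drop (k + j)).map some)
    (fun j => (l.take (k + j)).reverse.map some) (T := 2) fun j hj c => ?_
  by_cases h : k + j < l.length
  · refine (Runs.pop (T := 1) ?_).mono le_rfl
    rw [show l.drop (k + j) = l[k + j] :: l.drop (k + j + 1) from List.drop_eq_getElem_cons h]
    refine (Runs.push (s := stk ((l.drop (k + j + 1)).map some) [] (works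
      (List.replicate n (some true)) c ((l.take (k + j)).reverse.map some) [] [] []))
      (.w .top) (some l[k + j]) rfl).congr (by simp [st]) ?_ le_rfl
    have htake : (l.take (k + j + 1)).reverse.map some =
        some l[k + j] :: (l.take (k + j)).reverse.map some := by
      rw [List.take_succ_eq_append_getElem h, List.reverse_append, List.reverse_singleton,
        List.singleton_append, List.map_cons]
    rw [← add_assoc, htake]
    simp [st]
  · rw [List.drop_of_length_le (by omega), List.drop_of_length_le (by omega),
      List.take_of_length_le (by omega), List.take_of_length_le (by omega)]
    exact (Runs.pop (.skip _)).congr rfl (by simp [st]) le_rfl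

/-- Convert the digits on the main stack, most significant digit first, to a number. -/
def convertDigits : Prog (Option Bool) (Option Bool) :=
  .seq (pour .top .x) (.seq (pour .x .y) (.seq (.push (.w .top) none) (pour .y .top)))

theorem runs_convertDigits (n j : ℕ) :
    Runs convertDigits (st [] [] n [] (j.bits.reverse.map some)) (st [] [] n [] (enc j))
      (6 * j.bits.length + 7) := by
  refine ((runs_pour [] [] .top .x (by simp) (works (List.replicate n (some true)) []
    (j.bits.reverse.map some) [] [] [])).seq (((runs_pour_x_y [] [] (List.replicate n (some true))
      [] [] (j.bits.map some) [] []).congr (by simp) rfl le_rfl).seq ((Runs.push _ _ rfl).seq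
      ((runs_pour [] [] .y .top (by simp) (works (List.replicate n (some true)) []
    [none] [] (j.bits.reverse.map some) [])).congr (by simp) rfl le_rfl)))).congr rfl ?_ ?_
  · simp [st, enc]
  · simp; omega

/-- Output a word that is on the main stack. -/
def outputWord : Prog (Option Bool) (Option Bool) :=
  .seq (.loop (.w .top) (fun a => a = some (some true)) fun a =>
    if a = some (some true) then .pop (.w .top) fun b => .push (.w .x) (b.getD none) else .skip)
    (drain .x fun a => .push .out a)

theorem runs_outputWord (n : ℕ) (w : List Bool) :
    Runs outputWord (st [] [] n [] (enc w))
      (stk [] (w.map some) (works (List.replicate n (some true)) [] [] [] [] []))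
      (5 * w.length + 4) := by
  have h₁ : ∀ (w : List Bool) (n x : List Sym),
      Runs (.loop (.w .top) (fun a => a = some (some true)) fun a =>
        if a = some (some true) then .pop (.w .top) fun b => .push (.w .x) (b.getD none)
        else .skip : Prog (Option Bool) (Option Bool))
      (stk [] [] (works n [] (enc w) x [] []))
      (stk [] [] (works n [] [] (w.reverse.map some ++ x) [] [])) (3 * w.length + 2) := by
    intro w
    induction w with
    | nil =>
      exact fun n x => (Runs.loop_exit (s := stk [] [] (works n [] [some false] x [] []))
        (by simp) (.skip _)).congr rfl (by simp) (by simp)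
    | cons b w ih =>
      intro n x
      refine (Runs.loop_next (by simp [enc, encList]) (.pop (.push _ _ rfl))
        ((ih n (some b :: x)).congr (by simp [enc, encList]) rfl le_rfl)).congr rfl ?_ ?_
      · simp
      · simp; omega
  have h₂ : ∀ (w : List Bool) (n : List Sym) (o : List (Option Bool)),
      Runs (drain .x fun a => .push .out a : Prog (Option Bool) (Option Bool))
      (stk [] o (works n [] [] (w.map some) [] []))
      (stk [] (w.reverse.map some ++ o) (works n [] [] [] [] [])) (2 * w.length + 2) := by
    intro w
    induction w with
    | nil =>
      exact fun n o => (runs_drain_nil (k := .x) (s := stk [] o (works n [] [] [] [] [])) rfl).congr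
        rfl (by simp) (by simp)
    | cons b w ih =>
      intro n o
      refine (runs_drain_cons rfl (.push _ _ rfl) ((ih n (some b :: o)).congr (by simp) rfl
        le_rfl)).congr rfl ?_ ?_
      · simp
      · simp; omega
  refine ((h₁ w (List.replicate n (some true)) []).seq
    ((h₂ w.reverse (List.replicate n (some true)) []).congr (by simp) rfl le_rfl)).congr
      rfl (by simp) ?_
  simp; omega

theorem length_le_enc_length (w : List Bool) : w.length ≤ (enc w).length := by
  induction w with
  | nil => simp
  | cons b w ih =>
    have : enc (b :: w) = some true :: some b :: enc w := rfl
    rw [this]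
    simp only [List.length_cons]
    omega

/-- The time may depend on `n` only, whereas `j` is unbounded. So at most `n + 1` digits are saved;
if one more digit remains, then `2 ^ (n + 1) ≤ j`, and `hbig` allows the answer "too large" at once.
-/
theorem computable_of_poly_index {p : ℕ → ℕ → Bool} {s : ℕ → ℕ → List Bool} (hp : Poly p)
    (hs : Poly s) (hbig : ∀ n j, 2 ^ (n + 1) ≤ j → p n j = true) :
    ∃ q : Polynomial ℕ, ComputableInTime encodeIndexInput encodeIndexOutput
      (fun x : ℕ × ℕ => if p x.1 x.2 then none else some (s x.1 x.2))
      (fun x => q.eval x.1) := by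
  obtain ⟨P, T, hT, hP⟩ := (hp.pair hs).2 (Option Bool) (Option Bool)
  obtain ⟨q, hq⟩ : PolyBounded fun n (a : ℕ) => 10 * n + 9 + (1 + (6 * (n + 1) + 7 +
      (T n a + (1 + (5 * (enc (s n a)).length + 4))))) :=
    (((PolyBounded.const 10).mul .param).add (.const 9)).add ((PolyBounded.const 1).add
      ((((PolyBounded.const 6).mul (PolyBounded.param.add (.const 1))).add (.const 7)).add
        (hT.add ((PolyBounded.const 1).add (((PolyBounded.const 5).mul
          (PolyBounded.enc_length.comp hs.1)).add (.const 4))))))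
  let output : Prog (Option Bool) (Option Bool) := .pop (.w .top) fun b =>
    if b = some (some true) then .push .out none else outputWord
  let M : Prog (Option Bool) (Option Bool) := .seq (.seq readTally (repeated readBit))
    (.pop .inp fun a => if a.isSome then .push .out none else
      .seq convertDigits (.seq P output))
  have read : ∀ n j : ℕ, Runs (.seq readTally (repeated readBit))
      (stk (encodeIndexInput (n, j)) [] (works [] [] [] [] [] []))
      (st ((j.bits.drop (1 + n)).map some) [] n [] ((j.bits.take (1 + n)).reverse.map some))
      (10 * n + 9) := fun n j =>
    ((runs_readTally n j.bits []).seq ((runs_readBits n 1 j.bits).congr (by simp [st]) rfl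
      le_rfl)).congr (by simp [encodeIndexInput]) rfl (by omega)
  have hq' : ∀ n j, Nat.size j ≤ n + 1 → q.eval (n + size j) ≤ (q.comp (2 * Polynomial.X + 1)).eval n := by
    intro n j hj
    rw [Polynomial.eval_comp]
    refine eval_mono q ?_
    simp [size]
    omega
  refine ⟨q.comp (2 * Polynomial.X + 1) + 1, ?_⟩
  have := Runs.computable (ea := encodeIndexInput) (eb := encodeIndexOutput)
    (f := fun x : ℕ × ℕ => if p x.1 x.2 then none else some (s x.1 x.2))
    (time := fun x => (q.comp (2 * Polynomial.X + 1)).eval x.1) M ?_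
  · simpa using this
  · rintro ⟨n, j⟩
    by_cases hj : 2 ^ (n + 1) ≤ j
    · have hne : j.bits.drop (1 + n) ≠ [] := by
        have := Nat.lt_size.2 hj
        rw [← Nat.size_eq_bits_len] at this
        simp; omega
      obtain ⟨b, l, hl⟩ := List.exists_cons_of_ne_nil hne
      have h₁ : Runs M (stk (encodeIndexInput (n, j)) [] (works [] [] [] [] [] []))
          (stk (l.map some) [none] (works (List.replicate n (some true)) []
            ((j.bits.take (1 + n)).reverse.map some) [] [] [])) (10 * n + 9 + (1 + 1)) := by
        refine (read n j).seq (.pop ?_)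
        rw [hl]
        exact .push _ _ (by simp [st])
      refine ⟨_, h₁.mono ?_, ?_⟩
      -- No computation on `j` takes place here, so the bound is used at the index 0, which already
      -- covers the reading time.
      · refine le_trans ?_ ((hq n 0).trans (hq' n 0 (by simp)))
        dsimp only
        omega
      · simp [hbig n j hj, encodeIndexOutput]
    · have hj' : Nat.size j ≤ n + 1 := Nat.size_le.2 (by omega)
      have hlen : j.bits.length ≤ 1 + n := by
        rw [← Nat.size_eq_bits_len] at hj'
        omega
      have hr := read n j
      rw [List.drop_of_length_le hlen, List.take_of_length_le hlen] at hr
      have hout : ∃ g, Runs output (st [] [] n [] (enc (p n j, s n j))) g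
          (1 + (5 * (enc (s n j)).length + 4)) ∧
          g .out = encodeIndexOutput (if p n j then none else some (s n j)) := by
        cases h : p n j
        · refine ⟨_, (Runs.pop ((runs_outputWord n (s n j)).congr (by simp [st, enc]) rfl
            le_rfl)).mono ?_, by simp [encodeIndexOutput]⟩
          have := length_le_enc_length (s n j)
          omega
        · exact ⟨_, (Runs.pop (.push _ _ rfl)).mono (by omega), by
            simp [st, enc, encodeIndexOutput]⟩
      obtain ⟨g, hg, hgo⟩ := hout
      refine ⟨g, (hr.seq (.pop (((runs_convertDigits n j).congr (by simp [st]) rfl le_rfl).seq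
        (((hP n j [] [] [] []).congr (by simp) (by simp) le_rfl).seq hg)))).mono ?_, hgo⟩
      refine le_trans ?_ ((hq n j).trans (hq' n j hj'))
      dsimp only
      omega

end Index

end NecklaceIndexing

namespace NecklaceIndexing

/-! ### Periodic words all of whose windows exceed a given word -/

/-- At the position `p`, the sequence `f` exceeds the word `x` of length `n`, and they differ for
the first time at the index `k`. -/
def Jump (n : ℕ) (x : ℕ → Bool) (f : ℤ → Bool) (p : ℤ) (k : ℕ) : Prop :=
  k < n ∧ (∀ i < k, f (p + i) = x i) ∧ x k = false ∧ f (p + k) = true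

/-- At all positions, `f` exceeds `x`. -/
def Exceeds (n : ℕ) (x : ℕ → Bool) (f : ℤ → Bool) : Prop := ∀ p, ∃ k, Jump n x f p k

/-- All suffixes of the word `x` of length `n` are at least the prefix of the same length. -/
def Prenecklace (n : ℕ) (x : ℕ → Bool) : Prop :=
  ∀ i k, i + k < n → (∀ l < k, x (i + l) = x l) → x k = true → x (i + k) = true

/-- The part of `f` from `a` to `b` is a concatenation of words `x 0 … x (k - 1) 1` with
`x k = 0`. -/
inductive Cover (n : ℕ) (x : ℕ → Bool) (f : ℤ → Bool) : ℤ → ℤ → Prop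
  | refl (a) : Cover n x f a a
  | step {a b k} : Jump n x f a k → Cover n x f (a + (k + 1 : ℕ)) b → Cover n x f a b

/-- The first difference of `f` and `x` never is at `b` or later if the comparison starts
before `b`. -/
def Boundary (n : ℕ) (x : ℕ → Bool) (f : ℤ → Bool) (b : ℤ) : Prop :=
  ∀ q k, q < b → Jump n x f q k → q + k < b

section Jump

variable {n : ℕ} {x : ℕ → Bool} {f f' : ℤ → Bool} {a b p q : ℤ} {k k' : ℕ}

theorem Jump.unique (h : Jump n x f p k) (h' : Jump n x f p k') : k = k' := by
  obtain ⟨_, h₁, h₂, h₃⟩ := h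
  obtain ⟨_, h₁', h₂', h₃'⟩ := h'
  rcases lt_trichotomy k k' with hk | hk | hk
  · have := h₁' k hk
    simp_all
  · exact hk
  · have := h₁ k' hk
    simp_all

theorem Jump.congr (h : Jump n x f p k) (hf : ∀ i : ℕ, i ≤ k → f' (q + i) = f (p + i)) :
    Jump n x f' q k :=
  ⟨h.1, fun i hi => (hf i hi.le).trans (h.2.1 i hi), h.2.2.1, (hf k le_rfl).trans h.2.2.2⟩

/-- Before `p + k`, `f` reads a copy of `x`, so the comparison from `p + i` compares a suffix of
this copy with `x`. For a prenecklace a first difference there goes upwards. If there is none, `f`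
has a 1 at `p + k`, and `x (k - i)` must be 0, since otherwise `x k` would be 1. -/
theorem Jump.nest (hx : Prenecklace n x) (h : Jump n x f p k) {i : ℕ} (hi : i ≤ k) :
    ∃ k', k' + i ≤ k ∧ Jump n x f (p + i) k' := by
  obtain ⟨hk, h₁, h₂, h₃⟩ := h
  have hf : ∀ l, i + l < k → f (p + i + l) = x (i + l) := fun l hl => by
    rw [← h₁ (i + l) hl]; congr 1; push_cast; ring
  by_cases hall : ∀ l, i + l < k → x (i + l) = x l
  · refine ⟨k - i, by omega, by omega, fun l hl => ?_, ?_, ?_⟩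
    · rw [hf l (by omega), hall l (by omega)]
    · by_contra hc
      have := hx i (k - i) (by omega) (fun l hl => hall l (by omega)) (by simpa using hc)
      rw [show i + (k - i) = k by omega, h₂] at this
      simp at this
    · rw [← h₃]; congr 1; push_cast [hi]; ring
  · push Not at hall
    have hex : ∃ l, i + l < k ∧ x (i + l) ≠ x l := hall
    classical
    obtain ⟨hl, hne⟩ := Nat.find_spec hex
    set l := Nat.find hex
    have hmin : ∀ m < l, x (i + m) = x m := fun m hm => by
      have := Nat.find_min hex hm
      simp only [not_and, not_not] at this
      exact this (by omega)
    have hxl : x l = false := by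
      by_contra hc
      have hc' : x l = true := by simpa using hc
      exact hne ((hx i l (by omega) hmin hc').trans hc'.symm)
    refine ⟨l, by omega, by omega, fun m hm => ?_, hxl, ?_⟩
    · rw [hf m (by omega), hmin m hm]
    · rw [hf l hl]
      rw [hxl] at hne
      simpa using hne

theorem Cover.le (h : Cover n x f a b) : a ≤ b := by
  induction h with
  | refl => exact le_rfl
  | step _ _ ih => push_cast at ih; omega

theorem Cover.jump (hx : Prenecklace n x) (h : Cover n x f a b) (ha : a ≤ p) (hb : p < b) :
    ∃ k, Jump n x f p k ∧ p + k < b := by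
  induction h with
  | refl => omega
  | @step a b k hj hc ih =>
    by_cases hp : a + (k + 1 : ℕ) ≤ p
    · exact ih hp hb
    · obtain ⟨k', hk', h'⟩ := hj.nest hx (i := (p - a).toNat) (by omega)
      rw [show a + ((p - a).toNat : ℤ) = p by omega] at h'
      have := hc.le
      exact ⟨k', h', by omega⟩

/-- Blocks are taken greedily from `a`: each ends at a first difference, which cannot lie beyond
`b`. -/
theorem Boundary.cover (hb : Boundary n x f b) (hf : Exceeds n x f) (hab : a ≤ b) :
    Cover n x f a b := by
  obtain ⟨m, hm⟩ := Int.eq_ofNat_of_zero_le (sub_nonneg.2 hab)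
  induction m using Nat.strong_induction_on generalizing a with
  | _ m ih =>
    rcases hab.eq_or_lt with rfl | hlt
    · exact .refl _
    · obtain ⟨k, hk⟩ := hf a
      have := hb a k hlt hk
      exact .step hk (ih (m - (k + 1)) (by omega) (by push_cast; omega) (by push_cast; omega))

/-! ### Boundaries of periodic sequences -/

variable {g : ℕ}

theorem Jump.add_mul (hf : Function.Periodic f g) (h : Jump n x f p k) (z : ℤ) :
    Jump n x f (p + z * g) k :=
  h.congr fun i _ => by
    rw [show p + z * g + i = p + i + z * g by ring]
    exact hf.int_mul z _

theorem Boundary.add_mul (hf : Function.Periodic f g) (h : Boundary n x f b) (z : ℤ) :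
    Boundary n x f (b + z * g) := fun q k hq hj => by
  have := h (q + (-z) * g) k (by linarith) (hj.add_mul hf _)
  linarith

theorem Cover.exceeds (hx : Prenecklace n x) (hf : Function.Periodic f g) (hg : 0 < g)
    (h : Cover n x f 0 g) : Exceeds n x f := fun p => by
  obtain ⟨k, hk, _⟩ := h.jump hx (p := p % g) (Int.emod_nonneg _ (by omega))
    (Int.emod_lt_of_pos _ (by omega))
  have := hk.add_mul hf (p / g)
  rw [mul_comm, Int.emod_add_mul_ediv] at this
  exact ⟨k, this⟩

/-- Every comparison ends within the period in which it starts: reduce its start modulo `g` and use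
`Cover.jump`. -/
theorem Cover.boundary (hx : Prenecklace n x) (hf : Function.Periodic f g) (hg : 0 < g)
    (h : Cover n x f 0 g) : Boundary n x f 0 := fun q k hq hj => by
  obtain ⟨k', hk', hlt⟩ := h.jump hx (p := q % g) (Int.emod_nonneg _ (by omega))
    (Int.emod_lt_of_pos _ (by omega))
  have := hk'.add_mul hf (q / g)
  rw [mul_comm, Int.emod_add_mul_ediv] at this
  obtain rfl := hj.unique this
  have h₁ := Int.emod_add_mul_ediv q g
  have h₂ : q / g ≤ -1 := by
    have := Int.ediv_neg_of_neg_of_pos hq (show (0 : ℤ) < g by omega)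
    omega
  nlinarith

/-- The end of a longest jump is a boundary: jumps starting inside it nest, and jumps starting
earlier are no longer. Maximal `k` is obtained as minimal `n - k`. -/
theorem exists_boundary (hx : Prenecklace n x) (hf : Exceeds n x f) : ∃ b, Boundary n x f b := by
  classical
  have hex : ∃ m, ∃ q k, Jump n x f q k ∧ n - k = m :=
    ⟨_, 0, _, (hf 0).choose_spec, rfl⟩
  obtain ⟨q, k, hj, hm⟩ := Nat.find_spec hex
  refine ⟨q + k + 1, fun q' k' hq' hj' => ?_⟩
  have hk := hj.1
  have hk' := hj'.1
  have hmax : k' ≤ k := by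
    by_contra hc
    exact Nat.find_min hex (m := n - k') (by omega) ⟨q', k', hj', rfl⟩
  by_cases hqq : q ≤ q'
  · obtain ⟨k'', hk'', h''⟩ := hj.nest hx (i := (q' - q).toNat) (by omega)
    rw [show q + ((q' - q).toNat : ℤ) = q' by omega] at h''
    obtain rfl := h''.unique hj'
    omega
  · omega

/-- The sequence shifted by `o`. -/
def shift (o : ℤ) (f : ℤ → Bool) : ℤ → Bool := fun i => f (i + o)

theorem jump_shift (o : ℤ) : Jump n x (shift o f) p k ↔ Jump n x f (p + o) k := by
  constructor <;> intro h
  · exact h.congr fun i _ => by simp [shift, add_right_comm]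
  · exact h.congr fun i _ => by simp [shift, add_right_comm]

theorem boundary_shift (o : ℤ) : Boundary n x (shift o f) b ↔ Boundary n x f (b + o) := by
  constructor
  · intro h q k hq hj
    have := h (q - o) k (by omega) ((jump_shift o).2 (by rwa [sub_add_cancel]))
    omega
  · intro h q k hq hj
    have := h (q + o) k (by omega) ((jump_shift o).1 hj)
    omega

theorem exceeds_shift (o : ℤ) (h : Exceeds n x f) : Exceeds n x (shift o f) := fun p =>
  let ⟨k, hk⟩ := h (p + o)
  ⟨k, (jump_shift o).2 hk⟩

theorem periodic_shift (o : ℤ) (h : Function.Periodic f g) :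
    Function.Periodic (shift o f) g := fun i => by
  simp only [shift]
  rw [add_right_comm]
  exact h _

theorem shift_shift (o o' : ℤ) : shift o (shift o' f) = shift (o + o') f := by
  funext i
  simp [shift, add_assoc]

theorem shift_zero : shift 0 f = f := by
  funext i
  simp [shift]

end Jump

end NecklaceIndexing

namespace NecklaceIndexing

/-! ### The number of periodic words all of whose windows exceed a given word -/

/-- The word `x 0 … x (k - 1) 1`. -/
def block (x : ℕ → Bool) (k : ℕ) : List Bool := (List.range k).map x ++ [true]

/-- The concatenations of words `x 0 … x (k - 1) 1` with `x k = 0`. -/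
inductive Parse (n : ℕ) (x : ℕ → Bool) : List Bool → Prop
  | nil : Parse n x []
  | append {k w} : k < n → x k = false → Parse n x w → Parse n x (block x k ++ w)

/-- The part of `f` of length `m` from `a`. -/
def window (f : ℤ → Bool) (a : ℤ) (m : ℕ) : List Bool := (List.range m).map fun i : ℕ => f (a + i)

/-- The periodic continuation of a word of length `g`. -/
def cyclic (g : ℕ) (v : List Bool) : ℤ → Bool := fun i => v.getD (i % g).toNat false

/-- The coefficient with the index `i` of the recursion: whether there is a block of
length `i`. -/
def coef (n : ℕ) (x : ℕ → Bool) (i : ℕ) : ℕ := if 0 < i ∧ i ≤ n ∧ x (i - 1) = false then 1 else 0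

/-- The number of concatenations of blocks of total length `m`. -/
noncomputable def parseCount (n : ℕ) (x : ℕ → Bool) (m : ℕ) : ℕ := {w | Parse n x w ∧ w.length = m}.ncard

/-- The number of sequences of period `g` that exceed `x` at all positions. -/
noncomputable def exceedCount (n : ℕ) (x : ℕ → Bool) (g : ℕ) : ℕ :=
  {f : ℤ → Bool | Function.Periodic f g ∧ Exceeds n x f}.ncard

theorem ncard_eq_sum {α ι : Type*} {S : Set α} {t : Finset ι} {A : ι → Set α}
    (hS : S.Finite) (h : ∀ a, a ∈ S ↔ ∃ i ∈ t, a ∈ A i)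
    (hd : ∀ i ∈ t, ∀ j ∈ t, ∀ a, a ∈ A i → a ∈ A j → i = j) :
    S.ncard = ∑ i ∈ t, (A i).ncard := by
  classical
  have hA : ∀ i ∈ t, (A i).Finite := fun i hi => hS.subset fun a ha => (h a).2 ⟨i, hi, ha⟩
  have hS' : S = ↑(t.attach.biUnion fun i => (hA i i.2).toFinset) := by
    ext a
    simp [h]
  rw [hS', Set.ncard_coe_finset, Finset.card_biUnion, ← Finset.sum_attach t]
  · refine Finset.sum_congr rfl fun i _ => ?_
    rw [Set.ncard_eq_toFinset_card _ (hA i i.2)]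
  · intro i _ j _ hij
    refine Finset.disjoint_left.2 fun a hi hj => ?_
    exact hij (Subtype.ext (hd i i.2 j j.2 a (by simpa using hi) (by simpa using hj)))

variable {n g m : ℕ} {x : ℕ → Bool} {f : ℤ → Bool} {v w : List Bool} {a b : ℤ} {k : ℕ}

@[simp] theorem length_block : (block x k).length = k + 1 := by simp [block]

@[simp] theorem length_window : (window f a m).length = m := by simp [window]

theorem window_add (k m : ℕ) : window f a (k + m) = window f a k ++ window f (a + k) m := by
  simp [window, List.range_add, Function.comp_def, add_assoc]

theorem Jump.window (h : Jump n x f a k) : window f a (k + 1) = block x k := by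
  rw [window_add]
  congr 1
  · exact List.map_congr_left fun i hi => h.2.1 i (by simpa using hi)
  · simp [NecklaceIndexing.window, h.2.2.2]

/-- The blocks form a prefix code: the shorter block has a 1 at the index `k`, where the longer one
has `x k = 0`. -/
theorem block_inj {k k' : ℕ} {w w' : List Bool} (hk : x k = false) (hk' : x k' = false)
    (h : block x k ++ w = block x k' ++ w') : k = k' := by
  have key : ∀ {k k' : ℕ} {w w' : List Bool}, x k = false →
      block x k ++ w = block x k' ++ w' → ¬ k < k' := by
    intro k k' w w' hk h hlt
    have := congrArg (fun l => l[k]?) h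
    simp [block, hlt, List.getElem?_append, hk] at this
  exact le_antisymm (not_lt.1 (key hk' h.symm)) (not_lt.1 (key hk h))

theorem jump_of_window (hk : k < n) (hx : x k = false) (h : window f a (k + 1) = block x k) :
    Jump n x f a k := by
  rw [window_add] at h
  obtain ⟨h₁, h₂⟩ := List.append_inj h (by simp)
  exact ⟨hk, fun i hi => List.map_inj_left.1 h₁ i (by simpa using hi), hx,
    by simpa [NecklaceIndexing.window] using h₂⟩

theorem Parse.cover (h : Parse n x v) (hf : window f a v.length = v) :
    Cover n x f a (a + v.length) := by
  induction h generalizing a with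
  | nil => simpa using Cover.refl _
  | @append k w hk hx hw ih =>
    rw [List.length_append, length_block, window_add] at hf
    obtain ⟨h₁, h₂⟩ := List.append_inj hf (by simp)
    refine .step (jump_of_window hk hx h₁) ?_
    rw [List.length_append, length_block, Nat.cast_add (k + 1), ← add_assoc]
    exact ih h₂

theorem Cover.parse (h : Cover n x f a b) : Parse n x (window f a (b - a).toNat) := by
  induction h with
  | refl => simpa [window] using Parse.nil
  | @step a b k hj hc ih =>
    have := hc.le
    rw [show (b - a).toNat = (k + 1) + (b - (a + (k + 1 : ℕ))).toNat by omega, window_add,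
      hj.window]
    exact .append hj.1 hj.2.2.1 ih

theorem finite_parse : {w | Parse n x w ∧ w.length = m}.Finite :=
  (List.finite_length_eq Bool m).subset fun _ h => h.2

theorem parseCount_zero : parseCount n x 0 = 1 := by
  rw [parseCount, Set.ncard_eq_one]
  refine ⟨[], Set.eq_singleton_iff_unique_mem.2 ⟨⟨.nil, rfl⟩, fun w hw => ?_⟩⟩
  exact List.length_eq_zero_iff.1 hw.2

/-- Split off the first block, which is unique by `block_inj`. -/
theorem parseCount_pos (hm : 0 < m) :
    parseCount n x m = ∑ p ∈ Finset.HasAntidiagonal.antidiagonal m,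
      coef n x p.1 * parseCount n x p.2 := by
  rw [parseCount, ncard_eq_sum (t := Finset.HasAntidiagonal.antidiagonal m) (A := fun p =>
    {u | (0 < p.1 ∧ p.1 ≤ n ∧ x (p.1 - 1) = false) ∧
      ∃ w, (Parse n x w ∧ w.length = p.2) ∧ block x (p.1 - 1) ++ w = u}) finite_parse]
  · refine Finset.sum_congr rfl fun p _ => ?_
    by_cases hc : 0 < p.1 ∧ p.1 ≤ n ∧ x (p.1 - 1) = false
    · simp only [coef, hc, parseCount, and_self, true_and, if_true, one_mul]
      exact Set.ncard_image_of_injective _ (List.append_right_injective _)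
    · simp only [coef, hc, parseCount, false_and, if_false, zero_mul]
      simp
  · intro u
    constructor
    · rintro ⟨hu, rfl⟩
      cases hu with
      | nil => simp at hm
      | @append k w hk hx hw =>
        exact ⟨(k + 1, w.length), by simp, ⟨by simp, by simpa using hk, by simpa using hx⟩,
          w, ⟨hw, rfl⟩, rfl⟩
    · rintro ⟨⟨i, j⟩, hij, ⟨h₁, h₂, h₃⟩, w, ⟨h₄, rfl⟩, rfl⟩
      have : i + w.length = m := by simpa using hij
      exact ⟨.append (by simp at *; omega) h₃ h₄, by simp at *; omega⟩
  · rintro ⟨i, j⟩ hij ⟨i', j'⟩ hij' u ⟨h, w, hw, rfl⟩ ⟨h', w', hw', e⟩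
    have := block_inj h'.2.2 h.2.2 e
    simp only [Finset.HasAntidiagonal.mem_antidiagonal] at *
    ext <;> simp <;> omega

theorem periodic_cyclic : Function.Periodic (cyclic g v) g := fun i => by simp [cyclic]

theorem window_cyclic (hv : v.length = g) : window (cyclic g v) 0 g = v := by
  refine List.ext_getElem (by simp [hv]) fun i h₁ h₂ => ?_
  have : ((i : ℤ) % g).toNat = i := by
    rw [Int.emod_eq_of_lt (by omega) (by omega)]; simp
  simp [window, cyclic, this, h₂]

theorem cyclic_window (hg : 0 < g) (hf : Function.Periodic f g) :
    cyclic g (window f 0 g) = f := by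
  funext i
  have h₁ := Int.emod_nonneg i (show (g : ℤ) ≠ 0 by omega)
  have h₂ := Int.emod_lt_of_pos i (show (0 : ℤ) < g by omega)
  have h₃ : (i % g).toNat < g := by omega
  simp only [cyclic, window, zero_add, List.getD_eq_getElem?_getD, List.getElem?_map,
    List.getElem?_range h₃, Option.map_some, Option.getD_some, Int.toNat_of_nonneg h₁]
  have := hf.int_mul (i / g) (i % g)
  rw [← this, mul_comm]
  exact congrArg f (Int.emod_add_mul_ediv _ _)

theorem Boundary.next (hx : Prenecklace n x) (h : Boundary n x f b) (hj : Jump n x f b k) :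
    Boundary n x f (b + (k + 1 : ℕ)) := fun q k' hq hj' => by
  by_cases hqb : q < b
  · have := h q k' hqb hj'
    omega
  · obtain ⟨k'', hk'', h''⟩ := hj.nest hx (i := (q - b).toNat) (by omega)
    rw [show b + ((q - b).toNat : ℤ) = q by omega] at h''
    obtain rfl := h''.unique hj'
    omega

/-- The sequences for which the block that contains the position `0` has length `i` and starts at
the position `-o`. -/
def Located (n : ℕ) (x : ℕ → Bool) (g i o : ℕ) : Set (ℤ → Bool) :=
  {f | Function.Periodic f g ∧ Exceeds n x f ∧ Boundary n x f (-o) ∧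
    (∀ o' < o, ¬ Boundary n x f (-(o' : ℤ))) ∧ 0 < i ∧ Jump n x f (-o) (i - 1)}

/-- Such a sequence is the periodic continuation of the block of length `i` and a concatenation `w`
of blocks of length `j`, shifted by `o`. The number of choices of `w` does not depend on `o`. -/
theorem ncard_located (hx : Prenecklace n x) {i j o : ℕ} (ho : o < i) (hij : i + j = g) :
    (Located n x g i o).ncard = coef n x i * parseCount n x j := by
  by_cases hc : 0 < i ∧ i ≤ n ∧ x (i - 1) = false
  · rw [coef, if_pos hc, one_mul, parseCount]
    symm
    refine Set.ncard_congr (fun w _ => shift o (cyclic g (block x (i - 1) ++ w))) ?_ ?_ ?_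
    · rintro w ⟨hw, rfl⟩
      have hv : (block x (i - 1) ++ w).length = g := by simp; omega
      have hcov := (Parse.append (show i - 1 < n by omega) hc.2.2 hw).cover (a := 0)
        (f := cyclic g (block x (i - 1) ++ w)) (by rw [hv]; exact window_cyclic hv)
      rw [hv, zero_add] at hcov
      have hb := hcov.boundary hx periodic_cyclic (by omega)
      have hj : Jump n x (cyclic g (block x (i - 1) ++ w)) 0 (i - 1) := by
        have := window_cyclic hv
        have e := congrArg (window (cyclic g (block x (i - 1) ++ w)) 0)
          (show g = (i - 1 + 1) + w.length by omega)
        rw [window_add, this] at e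
        exact jump_of_window (by omega) hc.2.2 (List.append_inj e.symm (by simp)).1
      refine ⟨periodic_shift _ periodic_cyclic, exceeds_shift _
        (hcov.exceeds hx periodic_cyclic (by omega)), ?_, fun o' ho' h => ?_, hc.1, ?_⟩
      · rw [boundary_shift]; simpa using hb
      -- A boundary at `-o'` would lie strictly inside the first block and be crossed by the jump
      -- that starts this block.
      · rw [boundary_shift] at h
        have := h 0 (i - 1) (by omega) hj
        omega
      · rw [jump_shift]; simpa using hj
    · rintro w w' ⟨hw, hl⟩ ⟨hw', hl'⟩ h
      have h' := congrArg (shift (-(o : ℤ))) h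
      simp only [shift_shift, neg_add_cancel, shift_zero] at h'
      have h'' := congrArg (fun f => window f 0 g) h'
      rw [window_cyclic (by simp; omega), window_cyclic (by simp; omega)] at h''
      exact List.append_cancel_left h''
    · rintro f ⟨hp, he, hb, -, -, hj⟩
      have hp' := periodic_shift (-(o : ℤ)) hp
      have hb' : Boundary n x (shift (-(o : ℤ)) f) 0 := by rw [boundary_shift]; simpa using hb
      have hj' : Jump n x (shift (-(o : ℤ)) f) 0 (i - 1) := by rw [jump_shift]; simpa using hj
      have hg := (hb'.next hx hj').add_mul hp' 0
      have hbg := hb'.add_mul hp' 1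
      simp only [zero_add, one_mul] at hbg
      have hcov := (hbg.cover (exceeds_shift _ he) (a := i) (by omega)).parse
      rw [show ((g : ℤ) - i).toNat = j by omega] at hcov
      refine ⟨_, ⟨hcov, by simp⟩, ?_⟩
      rw [← hj'.window, show i - 1 + 1 = i by omega]
      have := window_add (f := shift (-(o : ℤ)) f) (a := 0) i j
      rw [zero_add] at this
      rw [← this, hij, cyclic_window (by omega) hp', shift_shift]
      simp [shift_zero]
  · rw [coef, if_neg hc, zero_mul]
    have : Located n x g i o = ∅ := Set.eq_empty_of_forall_notMem fun f hf =>
      hc ⟨hf.2.2.2.2.1, by have := hf.2.2.2.2.2.1; omega, hf.2.2.2.2.2.2.2.1⟩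
    rw [this, Set.ncard_empty]

theorem finite_periodic (hg : 0 < g) : {f : ℤ → Bool | Function.Periodic f g}.Finite :=
  ((List.finite_length_eq Bool g).image (cyclic g)).subset fun f hf =>
    ⟨window f 0 g, by simp, cyclic_window hg hf⟩

/-- Classify the sequences by the length `p.1` of the block containing the position 0 and by the
offset `o` of that position in the block; the `p.1` offsets give the factor. -/
theorem exceedCount_eq (hx : Prenecklace n x) (hg : 0 < g) :
    exceedCount n x g =
      ∑ p ∈ Finset.HasAntidiagonal.antidiagonal g, p.1 * coef n x p.1 * parseCount n x p.2 := by
  rw [exceedCount, ncard_eq_sum (t := (Finset.HasAntidiagonal.antidiagonal g).sigma fun p => Finset.range p.1)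
    (A := fun q => Located n x g q.1.1 q.2)
    ((finite_periodic hg).subset fun f hf => hf.1), Finset.sum_sigma]
  · refine Finset.sum_congr rfl fun p hp => ?_
    rw [Finset.sum_congr rfl fun o ho => ncard_located hx (Finset.mem_range.1 ho)
      (Finset.HasAntidiagonal.mem_antidiagonal.1 hp)]
    simp [mul_assoc]
  · intro f
    constructor
    · rintro ⟨hp, he⟩
      classical
      have hex : ∃ o : ℕ, Boundary n x f (-(o : ℤ)) := by
        obtain ⟨b, hb⟩ := exists_boundary hx he
        -- Translating `b` back by `|b|` periods makes it nonpositive.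
        refine ⟨(-(b + (-|b|) * g)).toNat, ?_⟩
        have := hb.add_mul hp (-|b|)
        rwa [Int.toNat_of_nonneg, neg_neg]
        have := le_abs_self b
        have := abs_nonneg b
        nlinarith
      have hb := Nat.find_spec hex
      set o := Nat.find hex
      obtain ⟨k, hk⟩ := he (-o)
      have hn := hb.next hx hk
      have ho : o < k + 1 := by
        by_contra hc
        refine Nat.find_min hex (m := o - (k + 1)) (by omega) ?_
        rwa [show -((o - (k + 1) : ℕ) : ℤ) = -o + (k + 1 : ℕ) by omega]
      -- One period later there is a boundary again, so the block has length at most `g`.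
      have hkg := hb.add_mul hp 1 (-o) k (by omega) hk
      refine ⟨⟨(k + 1, g - (k + 1)), o⟩, by simp; omega, hp, he, hb,
        fun o' ho' => Nat.find_min hex ho', by simp, hk⟩
    · rintro ⟨_, _, h⟩
      exact ⟨h.1, h.2.1⟩
  · rintro ⟨⟨i, j⟩, o⟩ h ⟨⟨i', j'⟩, o'⟩ h' f hf hf'
    have ho : o = o' := by
      rcases lt_trichotomy o o' with hlt | heq | hlt
      · exact absurd hf.2.2.1 (hf'.2.2.2.1 o hlt)
      · exact heq
      · exact absurd hf'.2.2.1 (hf.2.2.2.1 o' hlt)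
    subst ho
    have := hf.2.2.2.2.2.unique hf'.2.2.2.2.2
    have h₁ := hf.2.2.2.2.1
    have h₂ := hf'.2.2.2.2.1
    simp only [Finset.mem_sigma, Finset.HasAntidiagonal.mem_antidiagonal] at *
    obtain rfl : i = i' := by omega
    obtain rfl : j = j' := by omega
    rfl

/-- The recursion for the number of periodic sequences. -/
theorem exceedCount_rec (hx : Prenecklace n x) (hg : 0 < g) :
    exceedCount n x g = g * coef n x g +
      ∑ k ∈ Finset.range (g - 1), coef n x (k + 1) * exceedCount n x (g - 1 - k) := by
  -- Splitting off a block gives `H = 1 + C * H`, and `exceedCount_eq` says that `D * H` generates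
  -- the counts. Hence `D * H = D + C * (D * H)`, whose coefficient at `g` is the recursion.
  set C : PowerSeries ℕ := .mk (coef n x)
  set D : PowerSeries ℕ := .mk fun i => i * coef n x i
  set H : PowerSeries ℕ := .mk (parseCount n x)
  have hH : H = 1 + C * H := by
    ext m
    rcases m.eq_zero_or_pos with rfl | hm
    · simp [H, C, parseCount_zero, coef]
    · simp [H, C, PowerSeries.coeff_mul, PowerSeries.coeff_one, hm.ne', parseCount_pos hm]
  have hF : ∀ g, 0 < g → exceedCount n x g = PowerSeries.coeff g (D * H) := fun g hg => by
    simp [D, H, PowerSeries.coeff_mul, exceedCount_eq hx hg]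
  -- Period 0 is no condition, so `hF` needs `0 < g`; the vanishing constant term removes one end of
  -- the convolution, and `coef n x 0 = 0` the other.
  have hF0 : PowerSeries.coeff 0 (D * H) = 0 := by simp [D]
  have hDH : D * H = D + C * (D * H) := by
    conv_lhs => rw [hH]
    ring
  rw [hF g hg, hDH, map_add, PowerSeries.coeff_mul]
  congr 1
  · simp [D]
  · rw [Finset.Nat.sum_antidiagonal_eq_sum_range_succ_mk]
    obtain ⟨g, rfl⟩ := Nat.exists_eq_add_of_le' hg
    rw [Finset.sum_range_succ, Finset.sum_range_succ']
    simp only [Nat.sub_self, hF0, Nat.add_sub_cancel, C, PowerSeries.coeff_mk]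
    simp only [coef, lt_irrefl, false_and, if_false, zero_mul, mul_zero, add_zero]
    refine Finset.sum_congr rfl fun k hk => ?_
    rw [hF _ (by have := Finset.mem_range.1 hk; omega)]
    simp

end NecklaceIndexing

namespace NecklaceIndexing

/-! ### The table of the numbers of periodic words, and the necklaces above a word -/

/-- The letters of a word, continued by ones. -/
def letters (x : List Bool) : ℕ → Bool := fun i => x.getD i true

/-- The necklaces of length `n` all of whose representatives are greater than `x`. -/
def above (n : ℕ) (x : List Bool) : Set (Cycle Bool) :=
  {c | c ∈ necklaces n ∧ ∀ l : List Bool, (l : Cycle Bool) = c → x < l}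

variable {n g k : ℕ} {x : List Bool} {f : ℤ → Bool}

theorem foldl_dotStep (fs : List ℕ) (x : List Bool) (s : ℕ) :
    fs.foldl dotStep (x, s) = (x.drop fs.length,
      s + ∑ i ∈ Finset.range fs.length, if x.getD i true then 0 else fs.getD i 0) := by
  induction fs generalizing x s with
  | nil => simp
  | cons a fs ih =>
    rw [List.foldl_cons, dotStep, ih, List.length_cons, Finset.sum_range_succ']
    cases x <;> simp [add_assoc, add_comm]

theorem coef_letters (hx : x.length ≤ n) :
    coef n (letters x) (k + 1) = if x.getD k true then 0 else 1 := by
  simp only [coef, letters, Nat.succ_pos, true_and, Nat.add_sub_cancel, Nat.succ_le_iff]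
  rcases lt_or_ge k x.length with h | h
  · cases hk : x.getD k true <;> simp [h.trans_le hx]
  · simp [h]

/-- The previous entries are stored latest first, so pairing them with the letters of `x` from the
left evaluates the convolution in `exceedCount_rec`; the next letter decides about the term `g *
coef n x g`. -/
theorem table_eq (hx : x.length ≤ n) (hp : Prenecklace n (letters x)) :
    table n x = (List.range n).reverse.map fun i => exceedCount n (letters x) (i + 1) := by
  have key : ∀ k ≤ n, (fun s : ℕ × List ℕ => (s.1 + 1, tableEntry n x (s.1 + 1) s.2 :: s.2))^[k]
      (0, []) = (k, (List.range k).reverse.map fun i => exceedCount n (letters x) (i + 1)) := by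
    intro k hk
    induction k with
    | zero => rfl
    | succ k ih =>
      rw [Function.iterate_succ_apply', ih (by omega), List.range_succ, List.reverse_append,
        List.reverse_singleton, List.singleton_append, List.map_cons]
      congr 2
      rw [tableEntry, List.take_of_length_le (by simp; omega), foldl_dotStep,
        exceedCount_rec hp (by omega), coef_letters hx, add_comm, zero_add]
      congr 1
      · simp [← List.getD_eq_getElem?_getD]
      · simp only [List.length_map, List.length_reverse, List.length_range, Nat.add_sub_cancel]
        refine Finset.sum_congr rfl fun i hi => ?_
        have hi := Finset.mem_range.1 hi
        rw [coef_letters hx, ite_mul, zero_mul, one_mul]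
        congr 1
        simp [List.getD_eq_getElem?_getD, hi, show k - 1 - i + 1 = k - i by omega]
  rw [table, key n le_rfl]

theorem gcdStep_gcd (s : ℕ × ℕ) : (gcdStep s).1.gcd (gcdStep s).2 = s.1.gcd s.2 := by
  rw [gcdStep]
  split_ifs with h₁ h₂
  · rfl
  · exact Nat.gcd_sub_self_right h₂
  · simp only
    rw [Nat.gcd_sub_self_right (by omega), Nat.gcd_comm]

/-- The sum drops at each step until the first component is 0. It starts at no more than `2 * n`,
which is why `gcdN` makes two steps per round. -/
theorem gcdStep_le {s : ℕ × ℕ} {a : ℕ} (h : s.1 = 0 ∨ s.1 + s.2 ≤ a + 1) :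
    (gcdStep s).1 = 0 ∨ (gcdStep s).1 + (gcdStep s).2 ≤ a := by
  rw [gcdStep]
  split_ifs <;> omega

theorem gcdN_eq {a b : ℕ} (ha : a ≤ n) (hb : b ≤ n) : gcdN n a b = a.gcd b := by
  have key : ∀ k ≤ n, let s := (fun s => gcdStep (gcdStep s))^[k] (a, b)
      s.1.gcd s.2 = a.gcd b ∧ (s.1 = 0 ∨ s.1 + s.2 ≤ 2 * (n - k)) := by
    intro k hk
    induction k with
    | zero => exact ⟨rfl, .inr (by simp; omega)⟩
    | succ k ih =>
      obtain ⟨h₁, h₂⟩ := ih (by omega)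
      rw [Function.iterate_succ_apply']
      refine ⟨by rw [gcdStep_gcd, gcdStep_gcd, h₁], gcdStep_le (gcdStep_le ?_)⟩
      rwa [show 2 * (n - (k + 1)) + 1 + 1 = 2 * (n - k) by omega]
  obtain ⟨h₁, h₂⟩ := key n le_rfl
  rw [gcdN, ← h₁]
  rw [show Prod.fst _ = 0 by omega, Nat.gcd_zero_left]

theorem dropN_eq {α : Type} (l : List α) (hk : k ≤ n) : dropN n k l = l.drop k := by
  have key : ∀ m, (fun s : ℕ × List α => if s.1 = 0 then s else (s.1 - 1, s.2.tail))^[m] (k, l) =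
      (k - m, l.drop (min k m)) := by
    intro m
    induction m with
    | zero => simp
    | succ m ih =>
      rw [Function.iterate_succ_apply', ih]
      split_ifs with h
      · simp only at h
        rw [show min k (m + 1) = min k m by omega, show k - (m + 1) = k - m by omega]
      · simp only [List.tail_drop] at h ⊢
        rw [show min k (m + 1) = min k m + 1 by omega, show k - (m + 1) = k - m - 1 by omega]
  rw [dropN, key, min_eq_left hk]

theorem walkSum_eq_sum (hx : x.length ≤ n) (hp : Prenecklace n (letters x)) :
    walkSum n x = ∑ i ∈ Finset.range n, exceedCount n (letters x) ((i + 1).gcd n) := by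
  have key : ∀ k ≤ n, (fun s : ℕ × ℕ => (s.1 + 1, s.2 +
      (dropN n (n - gcdN n (s.1 + 1) n) (table n x)).headD 0))^[k] (0, 0) =
      (k, ∑ i ∈ Finset.range k, exceedCount n (letters x) ((i + 1).gcd n)) := by
    intro k hk
    induction k with
    | zero => rfl
    | succ k ih =>
      rw [Function.iterate_succ_apply', ih (by omega), Finset.sum_range_succ]
      congr 2
      simp only
      rw [dropN_eq _ (by omega), gcdN_eq (by omega) le_rfl, table_eq hx hp]
      have h₁ : 0 < (k + 1).gcd n := Nat.gcd_pos_of_pos_left _ (by omega)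
      have h₂ : (k + 1).gcd n ≤ n := Nat.gcd_le_right _ (by omega)
      generalize (k + 1).gcd n = d at *
      -- The table runs through the lengths `n, …, 1`, so `n - d` entries precede the one for the
      -- length `d`.
      rw [List.headD_eq_head?_getD, List.head?_drop]
      simp [show n - d < n by omega, show n - 1 - (n - d) + 1 = d by omega]
  rw [walkSum, key n le_rfl]

theorem shift_eq_self {a : ℤ} : shift a f = f ↔ Function.Periodic f a := funext_iff

theorem periodic_gcd (hf : Function.Periodic f n) {i : ℕ} :
    Function.Periodic f (i.gcd n : ℕ) ↔ Function.Periodic f i := by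
  constructor
  · intro h
    obtain ⟨z, hz⟩ := i.gcd_dvd_left n
    have := h.nat_mul z
    rwa [mul_comm, ← Nat.cast_mul, ← hz] at this
  · intro h
    rw [Nat.gcd_eq_gcd_ab, mul_comm (i : ℤ), mul_comm (n : ℤ)]
    exact (h.int_mul _).add_period (hf.int_mul _)

theorem Periodic.congr_of_emod (hf : Function.Periodic f n) {a b : ℤ} (h : a % n = b % n) :
    f a = f b := by
  have ha := hf.int_mul (a / n) (a % n)
  have hb := hf.int_mul (b / n) (b % n)
  simp only [Int.cast_id] at ha hb
  rw [mul_comm, Int.emod_add_mul_ediv] at ha hb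
  rw [ha, hb, h]

theorem window_eq_rotate (hn : 0 < n) (hf : Function.Periodic f n) (p : ℤ) :
    window f p n = (window f 0 n).rotate (p % n).toNat := by
  refine List.ext_getElem (by simp) fun i h₁ h₂ => ?_
  rw [List.getElem_rotate]
  simp only [window, List.getElem_map, List.getElem_range, List.length_map, List.length_range]
  refine Periodic.congr_of_emod hf ?_
  have := Int.emod_nonneg p (show (n : ℤ) ≠ 0 by omega)
  push_cast
  rw [Int.toNat_of_nonneg this]
  simp [add_comm]

theorem exists_jump_iff (hx : x.length = n) (p : ℤ) :
    (∃ k, Jump n (letters x) f p k) ↔ x < window f p n := by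
  rw [List.lt_iff_exists]
  simp only [length_window, hx, lt_irrefl, and_false, false_or]
  constructor
  · rintro ⟨k, hk, h₁, h₂, h₃⟩
    refine ⟨k, hk, hk, fun j hj => ?_, ?_⟩
    · have := h₁ j hj
      rw [letters, List.getD_eq_getElem _ _ (by omega)] at this
      simp [window, this]
    · rw [letters, List.getD_eq_getElem _ _ (by omega)] at h₂
      simp [window, h₂, h₃]
  · rintro ⟨k, hk, _, h₁, h₂⟩
    simp only [window, List.getElem_map, List.getElem_range, Bool.lt_iff] at h₁ h₂
    refine ⟨k, hk, fun i hi => ?_, ?_, h₂.2⟩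
    · rw [letters, List.getD_eq_getElem _ _ (by omega), h₁ i hi]
    · rw [letters, List.getD_eq_getElem _ _ (by omega), h₂.1]

theorem coe_window (hn : 0 < n) (hf : Function.Periodic f n) (p : ℤ) :
    (window f p n : Cycle Bool) = window f 0 n := by
  rw [window_eq_rotate hn hf, Cycle.coe_eq_coe]
  exact List.IsRotated.symm ⟨_, rfl⟩

theorem image_exceeds (hn : 0 < n) (hx : x.length = n) :
    (fun f => (window f 0 n : Cycle Bool)) ''
      {f | Function.Periodic f n ∧ Exceeds n (letters x) f} = above n x := by
  ext c
  constructor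
  · rintro ⟨f, ⟨hf, he⟩, rfl⟩
    refine ⟨by simp [necklaces], fun l hl => ?_⟩
    obtain ⟨t, ht⟩ := (Cycle.coe_eq_coe.1 hl).symm
    rw [← ht, ← List.rotate_mod, length_window]
    have := window_eq_rotate hn hf t
    rw [← Int.natCast_mod, Int.toNat_natCast] at this
    rw [← this, ← exists_jump_iff hx]
    exact he t
  · rintro ⟨hc, h⟩
    obtain ⟨l, rfl⟩ := Quotient.exists_rep c
    have hl : l.length = n := by simpa [necklaces] using hc
    refine ⟨cyclic n l, ⟨periodic_cyclic, fun p => (exists_jump_iff hx p).2 (h _ ?_)⟩, ?_⟩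
    · rw [coe_window hn periodic_cyclic, window_cyclic hl]; rfl
    · simp only [window_cyclic hl]; rfl

theorem coe_shift (hn : 0 < n) (hf : Function.Periodic f n) (p : ℤ) :
    (window (shift p f) 0 n : Cycle Bool) = window f 0 n := by
  rw [← coe_window hn hf p]
  congr 1
  simp [window, shift, add_comm]

theorem sum_range_periodic {P : ℕ → Prop} [DecidablePred P] (hP : Function.Periodic P n)
    (a b : ℕ) : (∑ i ∈ Finset.range n, if P (a + i) then 1 else 0) =
      ∑ i ∈ Finset.range n, if P (b + i) then 1 else 0 := by
  have h : ∀ a, (∑ i ∈ Finset.range n, if P (a + i) then 1 else 0) = n.count P := fun a => by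
    rw [← Nat.filter_Ico_card_eq_of_periodic a n P hP, Finset.card_filter,
      Finset.sum_Ico_eq_sum_range, Nat.add_sub_cancel_left]
  rw [h, h]

theorem coe_window_eq_iff (hn : 0 < n) {f f' : ℤ → Bool} (hf : Function.Periodic f n)
    (hf' : Function.Periodic f' n) :
    (window f' 0 n : Cycle Bool) = window f 0 n ↔ ∃ t < n, f' = shift t f := by
  constructor
  · intro h
    obtain ⟨t, ht⟩ := (Cycle.coe_eq_coe.1 h).symm
    refine ⟨t % n, Nat.mod_lt _ hn, ?_⟩
    rw [← cyclic_window hn hf', ← ht, ← List.rotate_mod, length_window]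
    have := window_eq_rotate hn hf (t % n : ℕ)
    rw [← Int.natCast_mod, Int.toNat_natCast, Nat.mod_mod] at this
    rw [← this, ← cyclic_window hn (periodic_shift (t % n : ℕ) hf)]
    congr 1
    simp [window, shift, add_comm]
  · rintro ⟨t, -, rfl⟩
    exact coe_shift hn hf t

/-- Burnside's lemma for the rotations of periodic sequences. -/
theorem sum_exceedCount (hn : 0 < n) (hx : x.length = n) :
    ∑ i ∈ Finset.range n, exceedCount n (letters x) ((i + 1).gcd n) = n * (above n x).ncard := by
  classical
  have hfin : {f : ℤ → Bool | Function.Periodic f n ∧ Exceeds n (letters x) f}.Finite :=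
    (finite_periodic hn).subset fun _ => And.left
  set S : Finset (ℤ → Bool) := hfin.toFinset
  have hS : ∀ f, f ∈ S ↔ Function.Periodic f n ∧ Exceeds n (letters x) f := fun f => by simp [S]
  set φ : (ℤ → Bool) → Cycle Bool := fun f => (window f 0 n : Cycle Bool)
  have hφ : (above n x).ncard = (S.image φ).card := by
    rw [← image_exceeds hn hx, ← Set.ncard_coe_finset]
    simp [S, φ]
  -- Among sequences of period `n`, those fixed by the rotation by `i + 1` are those of period `gcd
  -- (i + 1) n`.
  have h₁ : ∀ i, exceedCount n (letters x) ((i + 1).gcd n) =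
      (S.filter fun f => shift (i + 1 : ℕ) f = f).card := fun i => by
    rw [exceedCount, ← Set.ncard_coe_finset]
    congr 1
    ext f
    simp only [Set.mem_ofPred_eq, Finset.coe_filter, hS, shift_eq_self]
    constructor
    · rintro ⟨hp, he⟩
      have : Function.Periodic f n := by
        obtain ⟨z, hz⟩ := (i + 1).gcd_dvd_right n
        have := hp.nat_mul z
        rwa [mul_comm, ← Nat.cast_mul, ← hz] at this
      exact ⟨⟨this, he⟩, (periodic_gcd this).1 hp⟩
    · rintro ⟨⟨hp, he⟩, hi⟩
      exact ⟨(periodic_gcd hp).2 hi, he⟩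
  -- Each orbit contributes `n` in total: the rotations fixing an element `f'` of the orbit of `f`
  -- are as many as those taking `f` to `f'`, and each of the `n` rotations takes `f` to exactly one
  -- element.
  have h₂ : ∀ c ∈ S.image φ, ∑ f ∈ S with φ f = c, ∑ i ∈ Finset.range n,
      (if shift (i + 1 : ℕ) f = f then 1 else 0) = n := by
    intro c hc
    obtain ⟨f, hf, rfl⟩ := Finset.mem_image.1 hc
    have hp := ((hS f).1 hf).1
    have h₃ : ∀ f' ∈ S.filter fun f' => φ f' = φ f,
        (∑ i ∈ Finset.range n, if shift (i + 1 : ℕ) f' = f' then 1 else 0) =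
          ((Finset.range n).filter fun i : ℕ => shift (i + 1 : ℕ) f = f').card := by
      intro f' hf'
      rw [Finset.mem_filter, hS] at hf'
      obtain ⟨t, -, rfl⟩ := (coe_window_eq_iff hn hp hf'.1.1).1 hf'.2
      have hper : Function.Periodic (fun i : ℕ => shift i f = shift t f) n := fun i => by
        have : shift ((i + n : ℕ) : ℤ) f = shift i f := by
          rw [Nat.cast_add, ← shift_shift, shift_eq_self.2 hp]
        simp only [this]
      -- Here `f'` is `f` shifted by `t`. The sum over `n` consecutive shifts does not depend on the
      -- starting point, so the `t` can be dropped.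
      have := sum_range_periodic hper (1 + t) 1
      rw [Finset.card_filter]
      refine (Finset.sum_congr rfl fun i _ => ?_).trans
        (this.trans (Finset.sum_congr rfl fun i _ => ?_))
      · rw [shift_shift, ← Nat.cast_add, show i + 1 + t = 1 + t + i by ring]
      · rw [add_comm]
    rw [Finset.sum_congr rfl h₃, ← Finset.card_eq_sum_card_fiberwise
      (f := fun i : ℕ => shift (i + 1 : ℕ) f), Finset.card_range]
    intro i _
    simp only [Finset.coe_filter, Set.mem_ofPred_eq, hS]
    exact ⟨⟨periodic_shift _ hp, exceeds_shift _ ((hS f).1 hf).2⟩, coe_shift hn hp _⟩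
  simp_rw [h₁, Finset.card_filter]
  rw [Finset.sum_comm, ← Finset.sum_fiberwise_of_maps_to (t := S.image φ) (g := φ)
    (fun f hf => Finset.mem_image_of_mem _ hf), Finset.sum_congr rfl h₂, hφ]
  simp [mul_comm]

theorem walkSum_eq (hn : 0 < n) (hx : x.length = n) (hp : Prenecklace n (letters x)) :
    walkSum n x = n * (above n x).ncard := by
  rw [walkSum_eq_sum hx.le hp, sum_exceedCount hn hx]

end NecklaceIndexing

namespace NecklaceIndexing

/-! ### Correctness of the algorithms -/

variable {n m k j : ℕ} {x y w : List Bool} {c d : Cycle Bool}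

/-- Continuing `t` by ones ensures that a deciding position, where `t` has a 0, lies inside `t`. -/
theorem ltPrefix_iff (t y : List Bool) (ht : t.length ≤ n) : ltPrefix n t y = true ↔
    ∃ k, (∀ l < k, t.getD l true = y.getD l false) ∧
      t.getD k true = false ∧ y.getD k false = true := by
  have key : ∀ (t y : List Bool) (e b : Bool), (t.foldl ltStep (y, e, b)).2.2 = true ↔
      b = true ∨ e = true ∧ ∃ k, (∀ l < k, t.getD l true = y.getD l false) ∧
        t.getD k true = false ∧ y.getD k false = true := by
    intro t
    induction t with
    | nil => simp
    | cons a t ih =>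
      intro y e b
      rw [List.foldl_cons, ltStep, ih, ← Nat.or_exists_add_one
        (p := fun k => (∀ l < k, (a :: t).getD l true = y.getD l false) ∧
          (a :: t).getD k true = false ∧ y.getD k false = true)]
      simp only [Nat.forall_lt_succ_left]
      cases y <;> cases a <;> cases e <;> simp [and_assoc, or_assoc]
  rw [ltPrefix, List.take_of_length_le ht, key]
  simp

theorem isPre_iff (hy : y.length = n) : isPre n y = true ↔ Prenecklace n (letters y) := by
  have key : ∀ m, (fun s : List Bool × Bool => (s.1.tail, s.2 && !ltPrefix n s.1 y))^[m]
      (y, true) = (y.drop m, decide (∀ i < m, ltPrefix n (y.drop i) y = false)) := by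
    intro m
    induction m with
    | zero => simp
    | succ m ih =>
      rw [Function.iterate_succ_apply', ih]
      simp only [List.tail_drop, Nat.forall_lt_succ_right, Bool.decide_and]
      cases ltPrefix n (y.drop m) y <;> simp
  rw [isPre, key, decide_eq_true_iff]
  have hl : ∀ i < n, y.getD i false = letters y i := fun i hi => by
    simp [letters, hy, hi]
  constructor
  · intro h i k hik hl' hk
    by_contra hc
    have := h i (by omega)
    rw [← Bool.not_eq_true, ltPrefix_iff _ _ (by simp; omega)] at this
    refine this ⟨k, fun l hlk => ?_, ?_, ?_⟩
    · rw [hl l (by omega), ← hl' l hlk]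
      simp [letters]
    · simpa [letters] using hc
    · rw [hl k (by omega), hk]
  · intro h i hi
    rw [← Bool.not_eq_true, ltPrefix_iff _ _ (by simp; omega)]
    rintro ⟨k, h₁, h₂, h₃⟩
    have hik : i + k < n := by
      by_contra hc
      simp [show y.length ≤ i + k by omega] at h₂
    have := h i k hik (fun l hlk => ?_) (by rw [← hl k (by omega), h₃])
    · simp [letters] at this h₂
      simp [this] at h₂
    · rw [← hl l (by omega), ← h₁ l hlk]
      simp [letters]

theorem lt_iff_letters (hx : x.length = n) (hy : y.length = n) : x < y ↔
    ∃ k < n, (∀ i < k, letters y i = letters x i) ∧ letters x k = false ∧ letters y k = true := by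
  have h : ∀ i, ∀ h : i < n, letters x i = x[i] := fun i h => by simp [letters, hx, h]
  have h' : ∀ i, ∀ h : i < n, letters y i = y[i] := fun i h => by simp [letters, hy, h]
  rw [List.lt_iff_exists]
  simp only [hx, hy, lt_irrefl, and_false, false_or, Bool.lt_iff]
  constructor
  · rintro ⟨k, hk, _, h₁, h₂, h₃⟩
    exact ⟨k, hk, fun i hi => by rw [h i (by omega), h' i (by omega), h₁ i hi],
      (h k hk).trans h₂, (h' k hk).trans h₃⟩
  · rintro ⟨k, hk, h₁, h₂, h₃⟩
    exact ⟨k, hk, hk, fun i hi => by rw [← h i (by omega), ← h' i (by omega), h₁ i hi],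
      (h k hk).symm.trans h₂, (h' k hk).symm.trans h₃⟩

/-! ### Least representatives and ranks -/

theorem exists_least (c : Cycle Bool) :
    ∃ w : List Bool, (w : Cycle Bool) = c ∧ ∀ l : List Bool, (l : Cycle Bool) = c → w ≤ l := by
  have hfin : {l : List Bool | (l : Cycle Bool) = c}.Finite :=
    (List.finite_length_eq Bool c.length).subset fun l hl => by
      obtain rfl : (l : Cycle Bool) = c := hl
      rfl
  obtain ⟨w, hw, h⟩ := Set.exists_min_image _ id hfin (Quotient.exists_rep c)
  exact ⟨w, hw, h⟩

/-- The least representative of a necklace. -/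
noncomputable def least (c : Cycle Bool) : List Bool := (exists_least c).choose

@[simp] theorem coe_least : (least c : Cycle Bool) = c := (exists_least c).choose_spec.1

theorem least_le (h : (w : Cycle Bool) = c) : least c ≤ w := (exists_least c).choose_spec.2 w h

theorem length_least (hc : c ∈ necklaces n) : (least c).length = n := by
  have := congrArg Cycle.length (coe_least (c := c))
  exact this.trans hc

theorem mem_above : c ∈ above n x ↔ c ∈ necklaces n ∧ x < least c :=
  and_congr_right fun _ => ⟨fun h => h _ coe_least, fun h _ hl => h.trans_le (least_le hl)⟩

theorem above_subset : above n x ⊆ necklaces n := fun _ h => h.1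

theorem above_finite : (above n x).Finite := (necklaces_finite n).subset above_subset

theorem above_anti (h : x ≤ y) : above n y ⊆ above n x :=
  fun _ hc => ⟨hc.1, fun l hl => h.trans_lt (hc.2 l hl)⟩

/-- The position of a necklace in descending lexicographic order. -/
noncomputable def rank (c : Cycle Bool) : ℕ := (above c.length (least c)).ncard + 1

theorem rank_eq (hc : c ∈ necklaces n) : rank c = (above n (least c)).ncard + 1 := by
  rw [rank, show c.length = n from hc]

/-- The necklaces above `least c` all lie above `x`, and so does `c` itself, which accounts for the
summand 1 in the rank. -/
theorem rank_le_ncard_above (hc : c ∈ necklaces n) (h : x < least c) :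
    rank c ≤ (above n x).ncard := by
  rw [rank_eq hc, Nat.succ_le_iff]
  refine Set.ncard_lt_ncard ⟨above_anti h.le, fun hs => ?_⟩ above_finite
  exact lt_irrefl _ (mem_above.1 (hs (mem_above.2 ⟨hc, h⟩))).2

theorem rank_mem_Icc (hc : c ∈ necklaces n) : rank c ∈ Set.Icc 1 (numNecklaces n) := by
  rw [rank_eq hc]
  refine ⟨by omega, Set.ncard_lt_ncard ⟨above_subset, fun hs => ?_⟩ (necklaces_finite n)⟩
  exact lt_irrefl _ (mem_above.1 (hs hc)).2

theorem rank_injOn : Set.InjOn rank (necklaces n) := by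
  have key : ∀ {c d}, c ∈ necklaces n → d ∈ necklaces n → least c < least d →
      rank d < rank c := fun hc hd h => by
    rw [rank_eq hc]
    exact Nat.lt_succ_of_le (rank_le_ncard_above hd h)
  intro c hc d hd h
  rcases lt_trichotomy (least c) (least d) with hlt | heq | hlt
  · exact absurd h (key hc hd hlt).ne'
  · rw [← coe_least (c := c), heq, coe_least]
  · exact absurd h (key hd hc hlt).ne

theorem rank_bijOn : Set.BijOn rank (necklaces n) (Set.Icc 1 (numNecklaces n)) := by
  refine ⟨fun c hc => rank_mem_Icc hc, rank_injOn, ?_⟩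
  refine (Set.eq_of_subset_of_ncard_le (t := Set.Icc 1 (numNecklaces n))
    (Set.image_subset_iff.2 fun c hc => rank_mem_Icc hc) ?_ (Set.finite_Icc _ _)).ge
  rw [rank_injOn.ncard_image, ← numNecklaces]
  simp

theorem numNecklaces_le (n : ℕ) : numNecklaces n ≤ 2 ^ n := by
  have h : necklaces n ⊆ Set.range fun v : Fin n → Bool => (List.ofFn v : Cycle Bool) := by
    intro c hc
    have := length_least hc
    subst this
    exact ⟨(least c).get, by simp [List.ofFn_get]⟩
  refine (Set.ncard_le_ncard h (Set.finite_range _)).trans ?_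
  rw [← Set.image_univ]
  refine (Set.ncard_image_le).trans ?_
  simp [Set.ncard_univ]

theorem letters_rotate {i l : ℕ} (h : i + l < w.length) :
    letters (w.rotate i) l = letters w (i + l) := by
  have hl : l < (w.rotate i).length := by simp; omega
  rw [letters, letters, List.getD_eq_getElem _ _ h, List.getD_eq_getElem _ _ hl,
    List.getElem_rotate]
  simp only [add_comm l, Nat.mod_eq_of_lt h]

/-- A suffix smaller than the prefix of its length would make the rotation starting with it smaller
than the least representative. -/
theorem prenecklace_least (hc : c ∈ necklaces n) : Prenecklace n (letters (least c)) := by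
  intro i k hik hl hk
  by_contra hf
  have hn := length_least hc
  have hr : ((least c).rotate i : Cycle Bool) = c := by
    conv_rhs => rw [← coe_least (c := c)]
    exact Cycle.coe_eq_coe.2 (List.IsRotated.symm ⟨i, rfl⟩)
  refine (least_le hr).not_gt ((lt_iff_letters (by simpa using hn) hn).2
    ⟨k, by omega, fun l hlk => ?_, ?_, hk⟩)
  · rw [letters_rotate (by omega), hl l hlk]
  · rw [letters_rotate (by omega)]
    simpa using hf

/-- The condition only ever demands that some letter be 1, so continuing a prefix by ones cannot
violate it. -/
theorem Prenecklace.extend {x y : ℕ → Bool} (hx : Prenecklace n x) (h : ∀ i < k, y i = x i)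
    (h' : ∀ i, k ≤ i → y i = true) : Prenecklace n y := by
  intro i l hil hl hk
  by_cases hc : i + l < k
  · rw [h _ hc]
    refine hx i l hil (fun l' hl' => ?_) ?_
    · rw [← h _ (by omega), ← h _ (by omega), hl l' hl']
    · rw [← h _ (by omega), hk]
  · exact h' _ (by omega)

/-! ### Correctness of indexing -/

theorem revAppend_eq (u v : List Bool) (hu : u.length ≤ n) :
    revAppend n u v = u.reverse ++ v := by
  rw [revAppend, List.take_of_length_le hu]
  induction u generalizing v with
  | nil => rfl
  | cons a u ih => simp [ih _ (by simp at hu; omega)]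

theorem iterate_cons (a : Bool) (m : ℕ) : (fun l => a :: l)^[m] [] = List.replicate m a := by
  induction m with
  | zero => rfl
  | succ m ih => rw [Function.iterate_succ_apply', ih, List.replicate_succ]

theorem iterate_add (j m : ℕ) : (fun k => k + j)^[m] 0 = m * j := by
  induction m with
  | zero => simp
  | succ m ih => rw [Function.iterate_succ_apply', ih, Nat.succ_mul]

/-- The candidate `y` is the greatest word with the prefix of `w` of length `m` followed by 0. If `w
m = 0`, then `w ≤ y`, and fewer than `rank c` necklaces lie above `y`; if `w m = 1`, then `y < w`,
and at least `rank c` do. -/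
theorem chooseOne_eq (hc : c ∈ necklaces n) (hm : m < n) :
    chooseOne n (n * rank c) ((least c).take m ++ false :: List.replicate (n - (m + 1)) true) =
      letters (least c) m := by
  have hn := length_least hc
  set w := least c
  set y := w.take m ++ false :: List.replicate (n - (m + 1)) true with hydef
  have hy : y.length = n := by simp [y, hn]; omega
  have h₁ : ∀ i < m, letters y i = letters w i := fun i hi => by
    have : i < w.length := by omega
    simp [letters, y, List.getElem?_append, hi, this]
  have hm' : m ≤ w.length := by omega
  have h₂ : letters y m = false := by
    simp [letters, y, hm']
  have h₃ : ∀ i, m + 1 ≤ i → letters y i = true := fun i hi => by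
    obtain ⟨i, rfl⟩ := Nat.exists_eq_add_of_le hi
    simp only [letters, y, List.getD_eq_getElem?_getD, List.getElem?_append, List.length_take,
      min_eq_left hm', show ¬ m + 1 + i < m by omega, if_false,
      show m + 1 + i - m = i + 1 by omega, List.getElem?_cons_succ, List.getElem?_replicate]
    split_ifs <;> rfl
  rw [chooseOne]
  cases hwm : letters w m
  · have hp : Prenecklace n (letters y) := (prenecklace_least hc).extend (k := m + 1)
      (Nat.forall_lt_succ_right.2 ⟨h₁, h₂.trans hwm.symm⟩) h₃
    have hwy : w ≤ y := by
      by_contra hlt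
      rw [not_le, lt_iff_letters hy hn] at hlt
      obtain ⟨k, hk, h₄, h₅, h₆⟩ := hlt
      rcases lt_trichotomy k m with h | h | h
      · rw [h₁ k h, h₆] at h₅; simp at h₅
      · subst h; simp [hwm] at h₆
      · rw [h₃ k h] at h₅; simp at h₅
    rw [(isPre_iff hy).2 hp, walkSum_eq (by omega) hy hp, rank_eq hc]
    simp only [Bool.true_and, Bool.not_eq_false', decide_eq_true_eq]
    exact Nat.mul_lt_mul_of_pos_left
      (Nat.lt_succ_of_le (Set.ncard_le_ncard (above_anti hwy) above_finite)) (by omega)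
  -- If `y` is not a prenecklace, `walkSum` need not count anything, but then the letter 1 is chosen
  -- regardless, which is right here.
  · cases hp : isPre n y
    · rfl
    · have hyw : y < w := (lt_iff_letters hy hn).2 ⟨m, hm, fun i hi => (h₁ i hi).symm, h₂, hwm⟩
      rw [walkSum_eq (by omega) hy ((isPre_iff hy).1 hp)]
      simp only [Bool.true_and, Bool.not_eq_true', decide_eq_false_iff_not, not_lt]
      exact Nat.mul_le_mul_left _ (rank_le_ncard_above hc hyw)

theorem search_rank (hc : c ∈ necklaces n) : search n (n * rank c) = least c := by
  have hn := length_least hc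
  have key : ∀ m ≤ n, (searchStep n (n * rank c))^[m] (List.replicate n true, []) =
      (List.replicate (n - m) true, ((least c).take m).reverse) := by
    intro m hm
    induction m with
    | zero => simp
    | succ m ih =>
      rw [Function.iterate_succ_apply', ih (by omega), searchStep]
      have h : candidate n (List.replicate (n - m) true) ((least c).take m).reverse =
          (least c).take m ++ false :: List.replicate (n - (m + 1)) true := by
        rw [candidate, revAppend_eq _ _ (by simp; omega)]
        simp [Nat.sub_sub]
      simp only
      rw [h, chooseOne_eq hc hm]
      congr 1
      · simp [Nat.sub_sub]
      · rw [List.take_add_one, List.getElem?_eq_getElem (by omega), letters,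
          List.getD_eq_getElem _ _ (by omega), Option.toList_some, List.reverse_append,
          List.reverse_singleton, List.singleton_append]
  rw [search, iterate_cons, key n le_rfl, revAppend_eq _ _ (by simp)]
  simp [hn]

theorem replicate_false_le (hx : x.length = n) : List.replicate n false ≤ x := by
  by_contra h
  rw [not_le, lt_iff_letters hx (by simp)] at h
  obtain ⟨k, hk, _, _, h⟩ := h
  simp [letters, hk] at h

theorem above_replicate : above n (List.replicate n false) =
    necklaces n \ {(List.replicate n false : Cycle Bool)} := by
  ext c
  rw [mem_above, Set.mem_sdiff, Set.mem_singleton_iff]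
  refine and_congr_right fun hc => ⟨?_, fun h => ?_⟩
  · rintro h rfl
    exact h.not_ge (least_le rfl)
  · refine (replicate_false_le (length_least hc)).lt_of_ne ?_
    rintro e
    exact h (by rw [e, coe_least])

/-- All necklaces except that of the zero word lie above the zero word, which is a prenecklace; this
determines `n * numNecklaces n`. For `n = 0` the multiplied numbers carry no information, and the
only necklace is the empty one. -/
theorem tooLarge_iff : tooLarge n j = true ↔ numNecklaces n < j := by
  rcases n.eq_zero_or_pos with rfl | hn
  · have : numNecklaces 0 = 1 := by
      have h : necklaces 0 = {Cycle.nil} := by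
        ext c
        induction c using Quotient.inductionOn with
        | h l => simp [necklaces]
      rw [numNecklaces, h, Set.ncard_singleton]
    simp [tooLarge, this]
  · have hp : Prenecklace n (letters (List.replicate n false)) := fun i k hik _ hk => by
      simp [letters, show k < n by omega] at hk
    have hm : (List.replicate n false : Cycle Bool) ∈ necklaces n := by simp [necklaces]
    have h₁ : (above n (List.replicate n false)).ncard + 1 = numNecklaces n := by
      rw [above_replicate, numNecklaces, Set.ncard_sdiff_singleton_add_one hm (necklaces_finite n)]
    rw [tooLarge, iterate_cons, iterate_add, walkSum_eq hn (by simp) hp]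
    simp only [hn.ne', decide_false, Bool.false_and, Bool.or_false, decide_eq_true_eq]
    rw [← h₁, add_comm n, ← Nat.mul_succ]
    exact Nat.mul_lt_mul_left hn

theorem indexing_rank (hc : c ∈ necklaces n) : indexing n (rank c) = some (least c) := by
  rw [indexing, if_neg, iterate_add, search_rank hc]
  rw [tooLarge_iff, not_lt]
  exact (rank_mem_Icc hc).2

theorem isNecklaceIndexing_indexing : IsNecklaceIndexing indexing := by
  intro n
  have hr : ∀ j ∈ Set.Icc 1 (numNecklaces n), ∃ c ∈ necklaces n, rank c = j :=
    fun j hj => rank_bijOn.surjOn hj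
  have h : ∀ c ∈ necklaces n, (indexing n (rank c)).map
      (fun s : List Bool => (s : Cycle Bool)) = some c := fun c hc => by
    rw [indexing_rank hc, Option.map_some, coe_least]
  refine ⟨⟨fun j hj => ?_, fun j hj j' hj' hjj => ?_, ?_⟩, fun j hj => ?_⟩
  · obtain ⟨c, hc, rfl⟩ := hr j hj
    exact ⟨c, hc, (h c hc).symm⟩
  · obtain ⟨c, hc, rfl⟩ := hr j hj
    obtain ⟨d, hd, rfl⟩ := hr j' hj'
    simp only [h c hc, h d hd, Option.some.injEq] at hjj
    rw [hjj]
  · rintro _ ⟨c, hc, rfl⟩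
    exact ⟨rank c, rank_mem_Icc hc, h c hc⟩
  · rw [indexing, if_pos (tooLarge_iff.2 hj)]

/-! ### Correctness of reverse indexing -/

theorem divN_mul (hk : k < 2 ^ n) : divN n (n * k) = k := by
  rcases n.eq_zero_or_pos with rfl | hn
  · obtain rfl : k = 0 := by simpa using hk
    rfl
  have h₁ : ∀ m, (fun s : (ℕ × ℕ) × List (ℕ × ℕ) =>
      ((s.1.1 + s.1.1, s.1.2 + s.1.2), s.1 :: s.2))^[m] ((n, 1), []) =
      ((2 ^ m * n, 2 ^ m), (List.range m).reverse.map fun i => (2 ^ i * n, 2 ^ i)) := by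
    intro m
    induction m with
    | zero => simp
    | succ m ih =>
      rw [Function.iterate_succ_apply', ih, List.range_succ]
      simp [pow_succ, mul_two, add_mul]
  -- The invariant of long division: `m` binary digits of the quotient remain to be found, and `q`
  -- collects those already found.
  have h₂ : ∀ m k q, k < 2 ^ m → (((List.range m).reverse.map fun i =>
      (2 ^ i * n, 2 ^ i)).foldl divStep (n * k, q)).2 = q + k := by
    intro m
    induction m with
    | zero => simp
    | succ m ih =>
      intro k q hk
      rw [List.range_succ, List.reverse_append, List.reverse_singleton, List.singleton_append,
        List.map_cons, List.foldl_cons, divStep]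
      rw [pow_succ] at hk
      by_cases hle : 2 ^ m ≤ k
      · have : 2 ^ m * n ≤ n * k := by rw [mul_comm]; exact Nat.mul_le_mul_left _ hle
        simp only [this, if_true]
        rw [mul_comm (2 ^ m) n, ← Nat.mul_sub, ih _ _ (by omega)]
        omega
      · split_ifs with h
        · rw [mul_comm] at h
          exact absurd (Nat.le_of_mul_le_mul_left h hn) hle
        · exact ih k q (by omega)
  rw [divN, powerList, h₁, List.take_of_length_le (by simp), h₂ n k 0 hk, zero_add]

theorem rotate₁_eq (hy : y.length = n) : rotate₁ n y = y.rotate 1 := by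
  subst hy
  cases y with
  | nil => rfl
  | cons a t =>
    rw [rotate₁, revAppend_eq _ _ (by simp [revAppend]), revAppend_eq _ _ (by simp)]
    simp

/-- No rotation has more necklaces above it than the least one, which is a prenecklace. So the
maximum of `walkSum` over the rotations that are prenecklaces is `n * (rank y - 1)`, and the least
rotation need not be identified. -/
theorem reverseIndexing_eq (y : List Bool) : reverseIndexing y.length y = rank y := by
  set n := y.length with hn
  have hc : (y : Cycle Bool) ∈ necklaces n := by simp [necklaces, hn]
  suffices h : ((rankStep n)^[n] (y, 0)).2 = n * (above n (least y)).ncard by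
    rw [reverseIndexing, h, divN_mul, rank_eq hc]
    have := rank_mem_Icc hc
    rw [rank_eq hc] at this
    exact this.2.trans (numNecklaces_le n)
  have key : ∀ m ≤ n, ((rankStep n)^[m] (y, 0)).1 = y.rotate m ∧
      ((rankStep n)^[m] (y, 0)).2 ≤ n * (above n (least y)).ncard ∧
      ∀ t < m, y.rotate t = least y →
        n * (above n (least y)).ncard ≤ ((rankStep n)^[m] (y, 0)).2 := by
    intro m hm
    induction m with
    | zero => simp
    | succ m ih =>
      obtain ⟨h₁, h₂, h₃⟩ := ih (by omega)
      rw [Function.iterate_succ_apply']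
      generalize (rankStep n)^[m] (y, 0) = s at *
      rw [rankStep, h₁]
      have hl : (y.rotate m).length = n := by simp [hn]
      have hle : least y ≤ y.rotate m :=
        least_le (Cycle.coe_eq_coe.2 (List.IsRotated.symm ⟨m, rfl⟩))
      refine ⟨by rw [rotate₁_eq hl, List.rotate_rotate], ?_, ?_⟩
      · simp only [Bool.and_eq_true, decide_eq_true_eq]
        split_ifs with h
        · rw [walkSum_eq (by omega) hl ((isPre_iff hl).1 h.1)]
          exact Nat.mul_le_mul_left _ (Set.ncard_le_ncard (above_anti hle) above_finite)
        · exact h₂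
      · intro t ht h
        simp only [Bool.and_eq_true, decide_eq_true_eq]
        rcases (Nat.lt_succ_iff.1 ht).lt_or_eq with htm | rfl
        · have := h₃ t htm h
          split_ifs <;> omega
        · rw [h]
          have hp := prenecklace_least hc
          rw [(isPre_iff (length_least hc)).2 hp, walkSum_eq (by omega) (length_least hc) hp]
          simp only [true_and]
          split_ifs <;> omega
  obtain ⟨-, h₁, h₂⟩ := key n le_rfl
  refine le_antisymm h₁ ?_
  rcases Nat.eq_zero_or_pos n with h0 | hpos
  · simp [h0]
  · obtain ⟨t, ht⟩ := (Cycle.coe_eq_coe.1 (coe_least (c := (y : Cycle Bool)))).symm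
    exact h₂ (t % n) (Nat.mod_lt _ hpos) (by rw [hn, List.rotate_mod, ht])

end NecklaceIndexing

theorem mainTheorem3 :
    (∃ A : ℕ → ℕ → Option (List Bool), NecklaceIndexing.IsNecklaceIndexing A ∧
      ∃ p : Polynomial ℕ,
        NecklaceIndexing.ComputableInTime NecklaceIndexing.encodeIndexInput
          NecklaceIndexing.encodeIndexOutput (fun x : ℕ × ℕ => A x.1 x.2)
          (fun x : ℕ × ℕ => p.eval x.1)) ∧
    (∃ r : Cycle Bool → ℕ, NecklaceIndexing.IsNecklaceReverseIndexing r ∧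
      ∃ p : Polynomial ℕ,
        NecklaceIndexing.ComputableInTime (fun s : List Bool => s) Nat.bits
          (fun s : List Bool => r (s : Cycle Bool))
          (fun s : List Bool => p.eval s.length)) := by
  refine ⟨⟨_, NecklaceIndexing.isNecklaceIndexing_indexing, ?_⟩,
    ⟨NecklaceIndexing.rank, fun n => NecklaceIndexing.rank_bijOn, ?_⟩⟩
  · refine NecklaceIndexing.computable_of_poly_index NecklaceIndexing.poly_tooLarge
      NecklaceIndexing.poly_search_mul fun n j hj => NecklaceIndexing.tooLarge_iff.2 ?_
    -- An index of more than `n + 1` binary digits exceeds `2 ^ n`, hence the number of necklaces.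
    have := NecklaceIndexing.numNecklaces_le n
    rw [pow_succ] at hj
    have := Nat.two_pow_pos n
    omega
  · obtain ⟨p, hp⟩ := NecklaceIndexing.computable_of_poly NecklaceIndexing.poly_reverseIndexing
    refine ⟨p, ?_⟩
    simpa only [NecklaceIndexing.reverseIndexing_eq] using hp
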